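/- Let $X$ be a compact Hausdorff space of Lebesgue covering dimension zero (not necessarily metrizable), and let $A$ be a (not necessarily unital) continuous $C(X)$-algebra. If every fiber $A(x)$, $x\in X$, is rationally $K$-stable, then $A$ is rationally $K$-stable. Here the following terminology is used. A $C(X)$-algebra is a C*-algebra $A$ with a unital $*$-homomorphism $\theta: C(X)\to Z(M(A))$ into the centre of its multiplier algebra; one writes $fa=\theta(f)(a)$. For $x\in X$, the fiber $A(x)$ is the quotient of $A$ by the closed ideal $C_0(X,\{x\})A$, the closed linear span of the elements $fa$ with $a\in A$, $f\in C(X)$ and $f(x)=0$, and $a(x)$ is the image of $a\in A$ in $A(x)$. The $C(X)$-algebra $A$ is continuous if $x\mapsto \|a(x)\|$ is continuous for every $a\in A$. For a C*-algebra $B$, put $a\cdot b=a+b-ab$. A quasi-unitary of $B$ is an element $u\in B$ with $u\cdot u^*=u^*\cdot u=0$; the quasi-unitaries form a topological group $\widehat{\mathcal U}(B)$ under $\cdot$ with unit $0$. Let $\widehat{\mathcal U}_0(B)$ be the subgroup of those quasi-unitaries that are joined to $0$ by a path in $\widehat{\mathcal U}(B)$, and let $F_m(B)=\pi_m(\widehat{\mathcal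 U}_0(B),0)\otimes_{\mathbb Z}\mathbb Q$ for $m\ge 1$. The C*-algebra $B$ is rationally $K$-stable if, for all $m\ge 1$ and $j\ge 2$, the map $F_m(M_{j-1}(B))\to F_m(M_j(B))$ induced by $a\mapsto \begin{pmatrix} a&0\\0&0\end{pmatrix}$ is an isomorphism. -/

import Mathlib

open scoped TensorProduct MultiplierAlgebra

noncomputable section

namespace RatKStable

/-! ### Covering dimension -/

/-- Every finite open cover of `X` has a finite open refinement that is again a cover and such that
every point of `X` lies in at most `k` members of the refinement. -/
def HasRefinementsOfOrder (X : Type*) [TopologicalSpace X] (k : ℕ) : Prop :=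
  ∀ 𝒰 : Set (Set X), 𝒰.Finite → (∀ U ∈ 𝒰, IsOpen U) → ⋃₀ 𝒰 = Set.univ →
    ∃ 𝒱 : Set (Set X), 𝒱.Finite ∧ (∀ V ∈ 𝒱, IsOpen V) ∧ ⋃₀ 𝒱 = Set.univ ∧
      (∀ V ∈ 𝒱, ∃ U ∈ 𝒰, V ⊆ U) ∧ ∀ x : X, {V ∈ 𝒱 | x ∈ V}.encard ≤ k

open Classical in
/-- The Lebesgue covering dimension: `⊥` for the empty space, and otherwise the least `n` such that
every finite open cover has a finite open refinement in which each point lies in at most `n + 1`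
members (`⊤` if there is no such `n`). -/
def coveringDim (X : Type*) [TopologicalSpace X] : WithBot ℕ∞ :=
  if IsEmpty X then ⊥
  else ((⨅ n ∈ {n : ℕ | HasRefinementsOfOrder X (n + 1)}, (n : ℕ∞) : ℕ∞) : WithBot ℕ∞)

/-! ### Homotopy groups: induced maps, and commutativity for topological groups -/

section Homotopy

variable {N Y Z : Type*} [TopologicalSpace Y] [TopologicalSpace Z] {y : Y} {z : Z}

/-- The class of a generalized loop in the homotopy group. -/
def cls (f : GenLoop N Y y) : HomotopyGroup N Y y := Quotient.mk _ f

theorem cls_mul [DecidableEq N] [Nonempty N] (i : N) (p q : GenLoop N Y y) :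
    cls p * cls q = cls (GenLoop.transAt i q p) := HomotopyGroup.mul_spec

theorem transAt_apply [DecidableEq N] (i : N) (f g : GenLoop N Y y) (t : N → unitInterval) :
    GenLoop.transAt i f g t = if (t i : ℝ) ≤ 1 / 2
      then f (Function.update t i (Set.projIcc 0 1 zero_le_one (2 * t i)))
      else g (Function.update t i (Set.projIcc 0 1 zero_le_one (2 * t i - 1))) := rfl

/-- Composition of a generalized loop with a based map. -/
def mapLoop (φ : C(Y, Z)) (h : φ y = z) (f : GenLoop N Y y) : GenLoop N Z z :=
  ⟨φ.comp f.1, fun t ht => (congrArg φ (f.2 t ht)).trans h⟩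

/-- The homomorphism of homotopy groups induced by a based map. -/
def homotopyMap (N : Type*) [DecidableEq N] [Nonempty N] (φ : C(Y, Z)) (h : φ y = z) :
    HomotopyGroup N Y y →* HomotopyGroup N Z z :=
  MonoidHom.mk'
    (Quotient.lift (fun f => cls (mapLoop φ h f)) fun _ _ H =>
      Quotient.sound (ContinuousMap.HomotopicRel.comp_continuousMap H φ)) (by
      rintro ⟨p⟩ ⟨q⟩
      have i : N := Classical.arbitrary N
      change Quotient.lift (fun f => cls (mapLoop φ h f)) _ (cls p * cls q) =
        cls (mapLoop φ h p) * cls (mapLoop φ h q)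
      rw [cls_mul i, cls_mul i]
      change cls (mapLoop φ h (GenLoop.transAt i q p)) = _
      congr 1
      ext t
      change φ (if _ then _ else _) = if _ then _ else _
      split_ifs <;> rfl)

variable {G : Type*} [TopologicalSpace G] [Group G] [ContinuousMul G]

/-- Pointwise product of generalized loops in a topological group. -/
def mulLoop (f g : GenLoop N G (1 : G)) : GenLoop N G (1 : G) :=
  ⟨f.1 * g.1, fun t ht => by
    change f.1 t * g.1 t = 1
    rw [f.2 t ht, g.2 t ht, one_mul]⟩

theorem mulLoop_homotopic {f f' g g' : GenLoop N G (1 : G)} (hf : GenLoop.Homotopic f f')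
    (hg : GenLoop.Homotopic g g') : GenLoop.Homotopic (mulLoop f g) (mulLoop f' g') := by
  obtain ⟨F⟩ := hf
  obtain ⟨H⟩ := hg
  refine ⟨⟨⟨F.toContinuousMap * H.toContinuousMap, fun x => ?_, fun x => ?_⟩, fun t x hx => ?_⟩⟩
  · change F (0, x) * H (0, x) = f.1 x * g.1 x
    rw [F.apply_zero, H.apply_zero]
  · change F (1, x) * H (1, x) = f'.1 x * g'.1 x
    rw [F.apply_one, H.apply_one]
  · change F (t, x) * H (t, x) = f.1 x * g.1 x
    rw [F.eq_fst t hx, H.eq_fst t hx]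

/-- The product on homotopy classes induced by the multiplication of a topological group. -/
def pointwiseMul (a b : HomotopyGroup N G (1 : G)) : HomotopyGroup N G (1 : G) :=
  Quotient.map₂ mulLoop (fun _ _ hf _ _ hg => mulLoop_homotopic hf hg) a b

/-- The homotopy groups of a topological group are commutative, in degree one as well
(Eckmann--Hilton). -/
theorem homotopyGroup_mul_comm [DecidableEq N] [Nonempty N] (a b : HomotopyGroup N G (1 : G)) :
    a * b = b * a := by
  have hu : EckmannHilton.IsUnital (pointwiseMul (N := N) (G := G)) (cls GenLoop.const) := by
    refine ⟨{ left_id := ?_, right_id := ?_ }⟩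
    · rintro ⟨f⟩
      change cls (mulLoop GenLoop.const f) = cls f
      congr 1
      ext t
      exact one_mul _
    · rintro ⟨f⟩
      change cls (mulLoop f GenLoop.const) = cls f
      congr 1
      ext t
      exact mul_one _
  have hd : ∀ a b c d : HomotopyGroup N G (1 : G),
      pointwiseMul (a * b) (c * d) = pointwiseMul a c * pointwiseMul b d := by
    rintro ⟨a⟩ ⟨b⟩ ⟨c⟩ ⟨d⟩
    have i : N := Classical.arbitrary N
    change pointwiseMul (cls a * cls b) (cls c * cls d) =
      cls (mulLoop a c) * cls (mulLoop b d)
    rw [cls_mul i, cls_mul i, cls_mul i]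
    change cls (mulLoop (GenLoop.transAt i b a) (GenLoop.transAt i d c)) = _
    congr 1
    ext t
    change GenLoop.transAt i b a t * GenLoop.transAt i d c t =
      GenLoop.transAt i (mulLoop b d) (mulLoop a c) t
    rw [transAt_apply, transAt_apply, transAt_apply]
    split_ifs <;> rfl
  exact (EckmannHilton.mul_comm hu EckmannHilton.MulOneClass.isUnital hd).comm a b

/-- The homotopy group, with its usual group structure, as a commutative group. -/
instance homotopyCommGroup [DecidableEq N] [Nonempty N] :
    CommGroup (HomotopyGroup N G (1 : G)) :=
  { HomotopyGroup.group N with mul_comm := homotopyGroup_mul_comm }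

end Homotopy

/-! ### Quasi-unitaries

These notions only involve the `*`-ring structure and the topology of a C*-algebra, and are defined
in that generality. -/

section QuasiUnitary

/-- The quasi-unitaries of `B`: the elements `u` with `u · u* = u* · u = 0`, where
`a · b = a + b - a b`. They carry the subspace topology. -/
def QuasiUnitary (B : Type*) [NonUnitalRing B] [StarRing B] : Type _ :=
  {u : B // u + star u - u * star u = 0 ∧ star u + u - star u * u = 0}

namespace QuasiUnitary

set_option linter.unusedSectionVars false

variable {B C : Type*} [NonUnitalRing B] [StarRing B] [NonUnitalRing C] [StarRing C]

theorem circ_assoc (a b c : B) :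
    (a + b - a * b) + c - (a + b - a * b) * c = a + (b + c - b * c) - a * (b + c - b * c) := by
  noncomm_ring

/-- The group of quasi-unitaries under `a · b = a + b - a b`, with unit `0` and inverse `u*`. -/
instance : Group (QuasiUnitary B) where
  mul u v := ⟨u.1 + v.1 - u.1 * v.1, by
    have hs : star (u.1 + v.1 - u.1 * v.1) = star v.1 + star u.1 - star v.1 * star u.1 := by
      rw [star_sub, star_add, star_mul, add_comm (star u.1)]
    rw [hs]
    constructor
    · rw [circ_assoc, ← circ_assoc v.1, v.2.1]
      simpa using u.2.1
    · rw [circ_assoc, ← circ_assoc (star u.1), u.2.2]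
      simpa using v.2.2⟩
  one := ⟨0, by simp⟩
  inv u := ⟨star u.1, by simpa using ⟨u.2.2, u.2.1⟩⟩
  mul_assoc u v w := Subtype.ext (circ_assoc u.1 v.1 w.1)
  one_mul u := Subtype.ext (by
    change 0 + u.1 - 0 * u.1 = u.1
    simp)
  mul_one u := Subtype.ext (by
    change u.1 + 0 - u.1 * 0 = u.1
    simp)
  inv_mul_cancel u := Subtype.ext u.2.2

variable [TopologicalSpace B] [IsTopologicalRing B] [ContinuousStar B]
variable [TopologicalSpace C] [IsTopologicalRing C] [ContinuousStar C]

instance : TopologicalSpace (QuasiUnitary B) := instTopologicalSpaceSubtype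

instance : IsTopologicalGroup (QuasiUnitary B) where
  continuous_mul := by
    refine Continuous.subtype_mk (f := fun p : QuasiUnitary B × QuasiUnitary B =>
      p.1.1 + p.2.1 - p.1.1 * p.2.1) ?_ _
    have h₁ : Continuous fun p : QuasiUnitary B × QuasiUnitary B => p.1.1 :=
      continuous_subtype_val.comp continuous_fst
    have h₂ : Continuous fun p : QuasiUnitary B × QuasiUnitary B => p.2.1 :=
      continuous_subtype_val.comp continuous_snd
    exact (h₁.add h₂).sub (h₁.mul h₂)
  continuous_inv :=
    Continuous.subtype_mk (f := fun u : QuasiUnitary B => star u.1)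
      (continuous_star.comp continuous_subtype_val) _

/-- The homomorphism of groups of quasi-unitaries induced by a `*`-homomorphism. -/
def map (φ : B →⋆ₙ+* C) : QuasiUnitary B →* QuasiUnitary C :=
  MonoidHom.mk'
    (fun u => ⟨φ u.1, by
      rw [← map_star, ← map_mul, ← map_mul, ← map_add, ← map_add, ← map_sub, ← map_sub,
        u.2.1, u.2.2, map_zero]
      exact ⟨rfl, rfl⟩⟩)
    (fun u v => Subtype.ext (by
      change φ (u.1 + v.1 - u.1 * v.1) = φ u.1 + φ v.1 - φ u.1 * φ v.1
      rw [map_sub, map_add, map_mul]))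

theorem continuous_map (φ : B →⋆ₙ+* C) (hφ : Continuous φ) : Continuous (map φ) :=
  Continuous.subtype_mk (f := fun u : QuasiUnitary B => φ u.1)
    (hφ.comp continuous_subtype_val) _

variable (B) in
/-- The subgroup of quasi-unitaries that are joined to `0` (the unit of the group) by a path of
quasi-unitaries. -/
def zeroComponent : Subgroup (QuasiUnitary B) where
  carrier := {u | Joined u 1}
  mul_mem' {u v} hu hv := by simpa using Joined.mul hu hv
  one_mem' := Joined.refl 1
  inv_mem' {u} hu := by simpa using Joined.inv hu

theorem map_mem_zeroComponent (φ : B →⋆ₙ+* C) (hφ : Continuous φ) {u : QuasiUnitary B}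
    (hu : u ∈ zeroComponent B) : map φ u ∈ zeroComponent C := by
  have h : Joined (map φ u) (map φ 1) := Joined.map hu (continuous_map φ hφ)
  rw [map_one] at h
  exact h

/-- The continuous map between the components of `0` induced by a continuous `*`-homomorphism. -/
def zeroComponentMap (φ : B →⋆ₙ+* C) (hφ : Continuous φ) :
    C(zeroComponent B, zeroComponent C) where
  toFun u := ⟨map φ u.1, map_mem_zeroComponent φ hφ u.2⟩
  continuous_toFun :=
    Continuous.subtype_mk ((continuous_map φ hφ).comp continuous_subtype_val) _

theorem zeroComponentMap_one (φ : B →⋆ₙ+* C) (hφ : Continuous φ) :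
    zeroComponentMap φ hφ 1 = 1 :=
  Subtype.ext (map_one (map φ))

end QuasiUnitary

end QuasiUnitary

/-! ### Rational nonstable K-groups and rational K-stability -/

section KStable

set_option linter.unusedSectionVars false

variable {B C : Type*} [NonUnitalRing B] [StarRing B] [NonUnitalRing C] [StarRing C]
variable [TopologicalSpace B] [IsTopologicalRing B] [ContinuousStar B]
variable [TopologicalSpace C] [IsTopologicalRing C] [ContinuousStar C]

/-- `F_m(B) = π_m(Û₀(B)) ⊗ ℚ` for `m ≥ 1`. -/
abbrev RatNonstableK (m : ℕ) [NeZero m] (B : Type*) [NonUnitalRing B] [StarRing B]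
    [TopologicalSpace B] [IsTopologicalRing B] [ContinuousStar B] : Type _ :=
  Additive (HomotopyGroup (Fin m) (QuasiUnitary.zeroComponent B)
    (1 : QuasiUnitary.zeroComponent B)) ⊗[ℤ] ℚ

/-- The map `F_m(φ) : F_m(B) → F_m(C)` induced by a continuous `*`-homomorphism. -/
def ratNonstableKMap (m : ℕ) [NeZero m] (φ : B →⋆ₙ+* C) (hφ : Continuous φ) :
    RatNonstableK m B →ₗ[ℤ] RatNonstableK m C :=
  LinearMap.rTensor ℚ
    (MonoidHom.toAdditive (homotopyMap (Fin m) (QuasiUnitary.zeroComponentMap φ hφ)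
      (QuasiUnitary.zeroComponentMap_one φ hφ))).toIntLinearMap

/-- The corner inclusion `M_n(B) → M_{n+1}(B)`, `a ↦ diag(a, 0)`. -/
def cornerInclusion (n : ℕ) (B : Type*) [NonUnitalRing B] [StarRing B] :
    Matrix (Fin n) (Fin n) B →⋆ₙ+* Matrix (Fin (n + 1)) (Fin (n + 1)) B where
  toFun a := (Matrix.fromBlocks a 0 0 (0 : Matrix (Fin 1) (Fin 1) B)).submatrix
    finSumFinEquiv.symm finSumFinEquiv.symm
  map_mul' a b := by
    rw [Matrix.submatrix_mul_equiv, Matrix.fromBlocks_multiply]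
    simp
  map_zero' := by simp
  map_add' a b := by
    ext i j
    refine Fin.addCases (fun i => ?_) (fun i => ?_) i <;>
      refine Fin.addCases (fun j => ?_) (fun j => ?_) j <;> simp
  map_star' a := by
    simp [Matrix.star_eq_conjTranspose, Matrix.conjTranspose_submatrix,
      Matrix.fromBlocks_conjTranspose]

theorem continuous_cornerInclusion (n : ℕ) : Continuous (cornerInclusion n B) :=
  (Continuous.matrix_fromBlocks continuous_id continuous_const continuous_const
    continuous_const).matrix_submatrix _ _

/-- `B` is rationally `K`-stable: `F_m(ι) : F_m(M_n(B)) → F_m(M_{n+1}(B))` is an isomorphism for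
all `m ≥ 1` and `n ≥ 1`. Matrix algebras carry the conjugate transpose and the entrywise topology,
which is the topology of the C*-norm when `B` is a C*-algebra. -/
def RationallyKStable (B : Type*) [NonUnitalRing B] [StarRing B]
    [TopologicalSpace B] [IsTopologicalRing B] [ContinuousStar B] : Prop :=
  ∀ (m : ℕ) [NeZero m] (n : ℕ), 1 ≤ n →
    Function.Bijective
      (ratNonstableKMap m (cornerInclusion n B) (continuous_cornerInclusion n))

end KStable

/-! ### `C(X)`-algebras -/

/-- A `C(X)`-algebra structure on the C*-algebra `A`: a unital `*`-homomorphism from `C(X)` into the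
centre of the multiplier algebra of `A`. -/
structure CXAlgebra (X A : Type*) [TopologicalSpace X] [NonUnitalCStarAlgebra A] where
  θ : C(X, ℂ) →⋆ₐ[ℂ] 𝓜(ℂ, A)
  mem_center : ∀ f, θ f ∈ Set.center 𝓜(ℂ, A)

namespace CXAlgebra

variable {X A : Type*} [TopologicalSpace X] [NonUnitalCStarAlgebra A] (E : CXAlgebra X A)

/-- The action `f a = θ(f)(a)` of `C(X)` on `A`. -/
def act (f : C(X, ℂ)) : A →L[ℂ] A := (E.θ f).fst

theorem eq_of_forall_mul_right {a b : A} (h : ∀ c, a * c = b * c) : a = b := by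
  rw [← sub_eq_zero, ← CStarRing.mul_star_self_eq_zero_iff, sub_mul, h, sub_self]

theorem eq_of_forall_mul_left {a b : A} (h : ∀ c, c * a = c * b) : a = b := by
  rw [← sub_eq_zero, ← CStarRing.star_mul_self_eq_zero_iff, mul_sub, h, sub_self]

theorem act_mul (f : C(X, ℂ)) (a b : A) : E.act f a * b = E.act f (a * b) :=
  eq_of_forall_mul_left fun c => by
    rw [act, ← mul_assoc, ← (E.θ f).central, ← (E.θ f).central, mul_assoc]

theorem mul_act (f : C(X, ℂ)) (a b : A) : a * E.act f b = E.act f (a * b) := by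
  have h := congrArg (fun T : 𝓜(ℂ, A) => T.fst b) ((E.mem_center f).comm (DoubleCentralizer.coe ℂ a))
  simpa [act] using h.symm

theorem snd_eq_act (f : C(X, ℂ)) (a : A) : (E.θ f).snd a = E.act f a :=
  eq_of_forall_mul_right fun c => by
    rw [(E.θ f).central, act_mul, ← mul_act]
    rfl

theorem star_act (f : C(X, ℂ)) (a : A) : star (E.act f a) = E.act (star f) (star a) := by
  have h : (E.θ (star f)).fst (star a) = star ((E.θ f).snd a) := by
    have hs : E.θ (star f) = star (E.θ f) := map_star E.θ f
    rw [hs, DoubleCentralizer.star_fst, star_star]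
  rw [← snd_eq_act, ← h]
  rfl

/-- The closed ideal `C₀(X, Y) A` of `A`: the closed linear span of the products `f a`, where
`f ∈ C(X)` vanishes on `Y` and `a ∈ A`. -/
def ideal (Y : Set X) : Submodule ℂ A :=
  (Submodule.span ℂ {b | ∃ f : C(X, ℂ), (∀ x ∈ Y, f x = 0) ∧ ∃ a : A, b = E.act f a}
    ).topologicalClosure

variable {E} in
theorem ideal_induction {Y : Set X} (T : A → A) (hT : Continuous T) (hT0 : T 0 = 0)
    (hadd : ∀ a b, T (a + b) = T a + T b) (hsmul : ∀ c : ℂ, ∃ d : ℂ, ∀ a, T (c • a) = d • T a)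
    (h : ∀ f : C(X, ℂ), (∀ x ∈ Y, f x = 0) → ∀ a, T (E.act f a) ∈ E.ideal Y) {b : A}
    (hb : b ∈ E.ideal Y) : T b ∈ E.ideal Y := by
  have hc : IsClosed (T ⁻¹' (E.ideal Y : Set A)) :=
    (Submodule.isClosed_topologicalClosure _).preimage hT
  have hs : ((Submodule.span ℂ {b | ∃ f : C(X, ℂ), (∀ x ∈ Y, f x = 0) ∧
      ∃ a : A, b = E.act f a} : Submodule ℂ A) : Set A) ⊆ T ⁻¹' (E.ideal Y : Set A) := by
    intro b hb
    change T b ∈ E.ideal Y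
    induction hb using Submodule.span_induction with
    | mem b hb =>
      obtain ⟨f, hf, a, rfl⟩ := hb
      exact h f hf a
    | zero => rw [hT0]; exact zero_mem _
    | add a b _ _ ha hb => rw [hadd]; exact add_mem ha hb
    | smul c a _ ha =>
      obtain ⟨d, hd⟩ := hsmul c
      rw [hd]
      exact Submodule.smul_mem _ _ ha
  exact closure_minimal hs hc hb

theorem act_mem_ideal {Y : Set X} {f : C(X, ℂ)} (hf : ∀ x ∈ Y, f x = 0) (a : A) :
    E.act f a ∈ E.ideal Y :=
  Submodule.le_topologicalClosure _ (Submodule.subset_span ⟨f, hf, a, rfl⟩)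

theorem mul_mem_ideal_left {Y : Set X} (a : A) {b : A} (hb : b ∈ E.ideal Y) :
    a * b ∈ E.ideal Y :=
  ideal_induction (fun b => a * b) (by fun_prop) (mul_zero a) (mul_add a)
    (fun c => ⟨c, fun b => mul_smul_comm c a b⟩)
    (fun f hf b => by rw [mul_act]; exact E.act_mem_ideal hf _) hb

theorem mul_mem_ideal_right {Y : Set X} (a : A) {b : A} (hb : b ∈ E.ideal Y) :
    b * a ∈ E.ideal Y :=
  ideal_induction (fun b => b * a) (by fun_prop) (zero_mul a) (fun b c => add_mul b c a)
    (fun c => ⟨c, fun b => smul_mul_assoc c b a⟩)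
    (fun f hf b => by rw [act_mul]; exact E.act_mem_ideal hf _) hb

theorem star_mem_ideal {Y : Set X} {b : A} (hb : b ∈ E.ideal Y) : star b ∈ E.ideal Y :=
  ideal_induction star continuous_star (star_zero A) star_add
    (fun c => ⟨star c, fun b => star_smul c b⟩)
    (fun f hf b => by
      rw [star_act]
      exact E.act_mem_ideal (fun x hx => by simp [hf x hx]) _) hb

instance isClosed_ideal (Y : Set X) : IsClosed (E.ideal Y : Set A) :=
  Submodule.isClosed_topologicalClosure _

/-- The restriction `A(Y) = A / C₀(X, Y) A`, with the quotient operations and the quotient norm. -/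
def Restriction (Y : Set X) : Type _ := A ⧸ E.ideal Y

/-- The quotient map `π_Y : A → A(Y)`. -/
def π (Y : Set X) (a : A) : E.Restriction Y := (E.ideal Y).mkQ a

namespace Restriction

variable (Y : Set X)

instance : NormedAddCommGroup (E.Restriction Y) :=
  inferInstanceAs (NormedAddCommGroup (A ⧸ E.ideal Y))

instance : NormedSpace ℂ (E.Restriction Y) :=
  inferInstanceAs (NormedSpace ℂ (A ⧸ E.ideal Y))

instance : CompleteSpace (E.Restriction Y) :=
  inferInstanceAs (CompleteSpace (A ⧸ E.ideal Y))

instance : Mul (E.Restriction Y) where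
  mul := Quotient.map₂ (fun a b : A => a * b) (by
    intro a a' ha b b' hb
    replace ha : a - a' ∈ E.ideal Y := (Submodule.quotientRel_def _).1 ha
    replace hb : b - b' ∈ E.ideal Y := (Submodule.quotientRel_def _).1 hb
    refine (Submodule.quotientRel_def _).2 ?_
    have h : a * b - a' * b' = (a - a') * b + a' * (b - b') := by noncomm_ring
    rw [h]
    exact add_mem (E.mul_mem_ideal_right _ ha) (E.mul_mem_ideal_left _ hb))

instance : Star (E.Restriction Y) where
  star := Quotient.map (fun a : A => star a) (by
    intro a a' ha
    replace ha : a - a' ∈ E.ideal Y := (Submodule.quotientRel_def _).1 ha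
    refine (Submodule.quotientRel_def _).2 ?_
    rw [← star_sub]
    exact E.star_mem_ideal ha)

theorem π_surjective : Function.Surjective (E.π Y) := Submodule.mkQ_surjective _

theorem π_add (a b : A) : E.π Y (a + b) = E.π Y a + E.π Y b := rfl

theorem π_mul (a b : A) : E.π Y (a * b) = E.π Y a * E.π Y b := rfl

theorem π_star (a : A) : E.π Y (star a) = star (E.π Y a) := rfl

theorem norm_π_le (a : A) : ‖E.π Y a‖ ≤ ‖a‖ := Submodule.Quotient.norm_mk_le (E.ideal Y) a

theorem exists_π_eq (b : E.Restriction Y) {ε : ℝ} (hε : 0 < ε) :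
    ∃ a : A, E.π Y a = b ∧ ‖a‖ < ‖b‖ + ε :=
  Submodule.Quotient.norm_mk_lt (S := E.ideal Y) b hε

instance : NonUnitalNormedRing (E.Restriction Y) where
  __ := (inferInstance : NormedAddCommGroup (E.Restriction Y))
  left_distrib a b c := by
    obtain ⟨a, rfl⟩ := π_surjective E Y a
    obtain ⟨b, rfl⟩ := π_surjective E Y b
    obtain ⟨c, rfl⟩ := π_surjective E Y c
    simp only [← π_add, ← π_mul, mul_add]
  right_distrib a b c := by
    obtain ⟨a, rfl⟩ := π_surjective E Y a
    obtain ⟨b, rfl⟩ := π_surjective E Y b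
    obtain ⟨c, rfl⟩ := π_surjective E Y c
    simp only [← π_add, ← π_mul, add_mul]
  zero_mul a := by
    obtain ⟨a, rfl⟩ := π_surjective E Y a
    exact congrArg (E.π Y) (zero_mul a)
  mul_zero a := by
    obtain ⟨a, rfl⟩ := π_surjective E Y a
    exact congrArg (E.π Y) (mul_zero a)
  mul_assoc a b c := by
    obtain ⟨a, rfl⟩ := π_surjective E Y a
    obtain ⟨b, rfl⟩ := π_surjective E Y b
    obtain ⟨c, rfl⟩ := π_surjective E Y c
    simp only [← π_mul, mul_assoc]
  norm_mul_le a b := by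
    have key : ∀ ε : ℝ, 0 < ε → ‖a * b‖ ≤ (‖a‖ + ε) * (‖b‖ + ε) := fun ε hε => by
      obtain ⟨a', rfl, ha⟩ := exists_π_eq E Y a hε
      obtain ⟨b', rfl, hb⟩ := exists_π_eq E Y b hε
      rw [← π_mul]
      exact (norm_π_le E Y _).trans ((norm_mul_le _ _).trans
        (mul_le_mul ha.le hb.le (norm_nonneg _) ((norm_nonneg _).trans ha.le)))
    have hlim : Filter.Tendsto (fun ε : ℝ => (‖a‖ + ε) * (‖b‖ + ε)) (nhdsWithin 0 (Set.Ioi 0))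
        (nhds ((‖a‖ + 0) * (‖b‖ + 0))) :=
      tendsto_nhdsWithin_of_tendsto_nhds (Continuous.tendsto (by fun_prop) 0)
    simp only [add_zero] at hlim
    exact ge_of_tendsto hlim (Filter.eventually_of_mem self_mem_nhdsWithin fun ε hε => key ε hε)

instance : StarRing (E.Restriction Y) where
  star_involutive a := by
    obtain ⟨a, rfl⟩ := π_surjective E Y a
    simp only [← π_star, star_star]
  star_mul a b := by
    obtain ⟨a, rfl⟩ := π_surjective E Y a
    obtain ⟨b, rfl⟩ := π_surjective E Y b
    simp only [← π_star, ← π_mul, star_mul]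
  star_add a b := by
    obtain ⟨a, rfl⟩ := π_surjective E Y a
    obtain ⟨b, rfl⟩ := π_surjective E Y b
    simp only [← π_star, ← π_add, star_add]

instance : NormedStarGroup (E.Restriction Y) where
  norm_star_le a := le_of_forall_pos_le_add fun ε hε => by
    obtain ⟨a', rfl, ha⟩ := exists_π_eq E Y a hε
    rw [← π_star]
    exact (norm_π_le E Y _).trans ((norm_star a').trans_le ha.le)

end Restriction

/-- The fiber `A(x) = A({x})`. -/
abbrev Fiber (x : X) : Type _ := E.Restriction {x}

/-- A `C(X)`-algebra is continuous if `x ↦ ‖a(x)‖` is continuous for every `a ∈ A`. -/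
def IsContinuous : Prop := ∀ a : A, Continuous fun x : X => ‖E.π {x} a‖

end CXAlgebra

end RatKStable

end

/-! Tensoring with `ℚ` inverts a homomorphism of abelian groups exactly when its kernel and cokernel
are torsion (`rTensor_rat_bijective_iff`). The task is thus to show this for the map induced by the
corner inclusion on `π_m` of quasi-unitaries of matrices over `A`, given the same for every fiber.
Torsion is a local condition over `X`, which allows patching.

Clopen sets form a basis of `X`, and each clopen `U` gives a cutoff endomorphism of `A`,
multiplication by its characteristic function. On `π_m` the cutoffs of disjoint sets multiply to the
cutoff of their union. By compactness, a property that holds near each point, passes to clopen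
subsets and survives disjoint unions holds globally (`clopens_top_of_local`); the exponents of
finitely many pieces are multiplied together.

To pass from a fiber to a neighborhood, `π_m` of the fiber must behave like the group of germs at
`x`: evaluation is onto (`evalPi_surjective`), and a class that evaluates trivially is already
killed by the cutoff to some clopen neighborhood (`exists_cutoffPi_eq_one`). The source is the norm
formula `‖a(x)‖ = inf ‖χ_U a‖` (`exists_norm_cutoff_lt`). A family of quasi-unitaries over a fiber
is lifted approximately to `A`; cutting off makes the lift nearly quasi-unitary, and the polar
decomposition repairs it. `IsGermMap` isolates what this argument needs. -/

noncomputable section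

namespace RatKStable

/-! ### Rationalization of abelian groups. -/

section Rationalization

variable {M N : Type*} [AddCommGroup M] [AddCommGroup N]

/-- `M ⊗ ℚ` is the localization of `M` at the nonzero integers, and the kernel of a localization map
is the torsion. -/
theorem tmul_one_eq_zero_iff (a : M) :
    a ⊗ₜ[ℤ] (1 : ℚ) = 0 ↔ ∃ k : ℕ, 0 < k ∧ k • a = 0 := by
  have h : (1 : ℚ) ⊗ₜ[ℤ] a = 0 ↔ ∃ c : nonZeroDivisors ℤ, c • a = 0 :=
    IsLocalizedModule.eq_zero_iff (nonZeroDivisors ℤ) (TensorProduct.mk ℤ ℚ M 1)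
  rw [← (TensorProduct.comm ℤ M ℚ).map_eq_zero_iff, TensorProduct.comm_tmul, h]
  constructor
  · rintro ⟨c, hc⟩
    refine ⟨(c : ℤ).natAbs, Int.natAbs_pos.2 (nonZeroDivisors.coe_ne_zero c), ?_⟩
    replace hc : (c : ℤ) • a = 0 := hc
    rw [← natCast_zsmul]
    rcases Int.natAbs_eq (c : ℤ) with h | h
    · rwa [← h]
    · rw [h, neg_smul, neg_eq_zero] at hc
      exact hc
  · rintro ⟨k, hk, h⟩
    exact ⟨⟨(k : ℤ), mem_nonZeroDivisors_of_ne_zero (by exact_mod_cast hk.ne')⟩, by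
      change (k : ℤ) • a = 0
      rwa [natCast_zsmul]⟩

theorem exists_nsmul_eq_tmul_one (z : M ⊗[ℤ] ℚ) :
    ∃ k : ℕ, 0 < k ∧ ∃ a : M, k • z = a ⊗ₜ[ℤ] (1 : ℚ) := by
  induction z using TensorProduct.induction_on with
  | zero => exact ⟨1, one_pos, 0, by simp⟩
  | tmul a q =>
    refine ⟨q.den, q.den_pos, q.num • a, ?_⟩
    rw [TensorProduct.smul_tmul, ← natCast_zsmul, ← TensorProduct.tmul_smul]
    congr 1
    simp [mul_comm]
  | add y z hy hz =>
    obtain ⟨k, hk, a, ha⟩ := hy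
    obtain ⟨l, hl, b, hb⟩ := hz
    refine ⟨k * l, Nat.mul_pos hk hl, l • a + k • b, ?_⟩
    rw [smul_add, TensorProduct.add_tmul, mul_comm k l, mul_smul, ha, mul_comm l k, mul_smul, hb]
    simp only [← natCast_zsmul, TensorProduct.smul_tmul']

/-- Multiplication by `1/k` on the factor `ℚ` undoes multiplication by `k`. -/
theorem eq_zero_of_nsmul_eq_zero {k : ℕ} (hk : 0 < k) {z : M ⊗[ℤ] ℚ} (h : k • z = 0) : z = 0 := by
  have key : ∀ z : M ⊗[ℤ] ℚ,
      LinearMap.lTensor M (LinearMap.mulLeft ℤ ((k : ℚ)⁻¹)) (k • z) = z := by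
    intro z
    rw [map_nsmul]
    induction z using TensorProduct.induction_on with
    | zero => simp
    | tmul a q =>
      rw [LinearMap.lTensor_tmul, ← natCast_zsmul, ← TensorProduct.tmul_smul]
      have : (k : ℚ) ≠ 0 := by exact_mod_cast hk.ne'
      simp [this]
    | add y z hy hz => rw [map_add, smul_add, hy, hz]
  rw [← key z, h, map_zero]

/-- A homomorphism of abelian groups is a rational isomorphism if and only if its kernel and
cokernel are torsion. -/
theorem rTensor_rat_bijective_iff (φ : M →ₗ[ℤ] N) :
    Function.Bijective (LinearMap.rTensor ℚ φ) ↔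
      (∀ a, φ a = 0 → ∃ k : ℕ, 0 < k ∧ k • a = 0) ∧ ∀ b, ∃ k : ℕ, 0 < k ∧ ∃ a, φ a = k • b := by
  constructor
  · rintro ⟨hi, hs⟩
    refine ⟨fun a ha => (tmul_one_eq_zero_iff a).1 (hi ?_), fun b => ?_⟩
    · rw [LinearMap.rTensor_tmul, ha, TensorProduct.zero_tmul, map_zero]
    · obtain ⟨z, hz⟩ := hs (b ⊗ₜ 1)
      obtain ⟨k, hk, a, ha⟩ := exists_nsmul_eq_tmul_one z
      -- The equation `φ a = k • b` holds only after tensoring, hence up to torsion; a further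
      -- multiple `l` makes it exact.
      have h : (φ a - k • b) ⊗ₜ[ℤ] (1 : ℚ) = 0 := by
        rw [TensorProduct.sub_tmul, ← LinearMap.rTensor_tmul, ← ha, map_nsmul, hz,
          ← natCast_zsmul, ← natCast_zsmul, TensorProduct.smul_tmul', sub_self]
      obtain ⟨l, hl, h⟩ := (tmul_one_eq_zero_iff _).1 h
      refine ⟨l * k, Nat.mul_pos hl hk, l • a, ?_⟩
      rw [map_nsmul, mul_smul, ← sub_eq_zero, ← smul_sub, h]
  · rintro ⟨hi, hs⟩
    refine ⟨(injective_iff_map_eq_zero _).2 fun z hz => ?_, fun z => ?_⟩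
    · obtain ⟨k, hk, a, ha⟩ := exists_nsmul_eq_tmul_one z
      have h : φ a ⊗ₜ[ℤ] (1 : ℚ) = 0 := by
        rw [← LinearMap.rTensor_tmul, ← ha, map_nsmul, hz, smul_zero]
      obtain ⟨l, hl, h⟩ := (tmul_one_eq_zero_iff _).1 h
      rw [← map_nsmul] at h
      obtain ⟨n, hn, h⟩ := hi _ h
      rw [← mul_smul] at h
      rw [(tmul_one_eq_zero_iff a).2 ⟨n * l, Nat.mul_pos hn hl, h⟩] at ha
      exact eq_zero_of_nsmul_eq_zero hk ha
    · obtain ⟨k, hk, b, hb⟩ := exists_nsmul_eq_tmul_one z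
      obtain ⟨l, hl, a, ha⟩ := hs b
      refine ⟨a ⊗ₜ ((l * k : ℕ) : ℚ)⁻¹, ?_⟩
      have hlk := Nat.mul_pos hl hk
      refine sub_eq_zero.1 (eq_zero_of_nsmul_eq_zero hlk ?_)
      have hq : ((l * k : ℕ) : ℤ) • (((l * k : ℕ) : ℚ)⁻¹) = 1 := by
        have : ((l * k : ℕ) : ℚ) ≠ 0 := by exact_mod_cast hlk.ne'
        rw [zsmul_eq_mul, Int.cast_natCast, mul_inv_cancel₀ this]
      rw [smul_sub, ← map_nsmul, ← natCast_zsmul (a ⊗ₜ[ℤ] _), ← TensorProduct.tmul_smul, hq,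
        LinearMap.rTensor_tmul, ha, mul_smul, hb, ← natCast_zsmul, ← natCast_zsmul,
        TensorProduct.smul_tmul', sub_self]

end Rationalization

/-! ### Clopen sets in dimension zero. -/

section ZeroDimensional

variable {X : Type*} [TopologicalSpace X]

theorem hasRefinementsOfOrder_one_of_coveringDim_eq_zero (hX : coveringDim X = 0) :
    HasRefinementsOfOrder X 1 := by
  rw [coveringDim] at hX
  split_ifs at hX
  · exact absurd hX WithBot.bot_ne_zero
  replace hX : (⨅ n ∈ {n : ℕ | HasRefinementsOfOrder X (n + 1)}, (n : ℕ∞)) = 0 :=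
    WithBot.coe_injective hX
  by_contra h
  have : (1 : ℕ∞) ≤ 0 := by
    rw [← hX]
    refine le_iInf₂ fun n hn => ?_
    rcases n with _ | n
    · exact absurd hn h
    · exact_mod_cast Nat.succ_pos n
  simp at this

/-- In a `T₁` space of covering dimension zero, the clopen sets form a basis. -/
theorem exists_isClopen_subset_of_coveringDim_eq_zero [T1Space X] (hX : coveringDim X = 0) {x : X}
    {W : Set X} (hW : IsOpen W) (hx : x ∈ W) : ∃ U, IsClopen U ∧ x ∈ U ∧ U ⊆ W := by
  -- In a refinement of `{W, {x}ᶜ}`, a member containing `x` cannot lie in `{x}ᶜ`, so it lies in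
  -- `W`.
  obtain ⟨𝒱, hfin, hopen, hcov, hsub, hord⟩ :=
    hasRefinementsOfOrder_one_of_coveringDim_eq_zero hX {W, {x}ᶜ} (by simp)
      (by simp [hW]) (by
        rw [Set.sUnion_pair, Set.eq_univ_iff_forall]
        intro y
        by_cases h : y = x
        · exact Or.inl (h ▸ hx)
        · exact Or.inr h)
  obtain ⟨V, hV, hxV⟩ : x ∈ ⋃₀ 𝒱 := hcov ▸ Set.mem_univ x
  -- Order one means that distinct members are disjoint, so the others fill exactly the complement
  -- of `V`.
  have hclosed : Vᶜ = ⋃₀ (𝒱 \ {V}) := by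
    ext y
    constructor
    · intro hy
      obtain ⟨V', hV', hyV'⟩ : y ∈ ⋃₀ 𝒱 := hcov ▸ Set.mem_univ y
      exact ⟨V', ⟨hV', fun h => hy (h ▸ hyV')⟩, hyV'⟩
    · rintro ⟨V', ⟨hV', hne⟩, hyV'⟩ hyV
      exact hne ((Set.encard_le_one_iff (s := {V ∈ 𝒱 | y ∈ V})).1 (by exact_mod_cast hord y)
        V' V ⟨hV', hyV'⟩ ⟨hV, hyV⟩)
  refine ⟨V, ⟨isOpen_compl_iff.1 ?_, hopen V hV⟩, hxV, ?_⟩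
  · rw [hclosed]
    exact isOpen_sUnion fun V' h => hopen V' h.1
  · obtain ⟨U, hU, hVU⟩ := hsub V hV
    rcases hU with rfl | rfl
    · exact hVU
    · exact absurd rfl (hVU hxV)

end ZeroDimensional

/-! ### Pointwise products of loops in a topological group. -/

section PointwiseProduct

variable {N G : Type*} [DecidableEq N] [Nonempty N] [TopologicalSpace G] [Group G] [ContinuousMul G]

/-- The product in a homotopy group of a topological group is represented by the pointwise
product. -/
theorem cls_mul_cls (f g : GenLoop N G (1 : G)) : cls f * cls g = cls (mulLoop f g) := by
  have i : N := Classical.arbitrary N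
  -- `cls_mul` concatenates in reverse order, so commutativity is used to put `f` first. The
  -- concatenation of `f` and `g` is then the pointwise product of `f` followed by a constant and a
  -- constant followed by `g`.
  rw [homotopyGroup_mul_comm, cls_mul i]
  have hf : GenLoop.Homotopic (GenLoop.transAt i f GenLoop.const) f := by
    refine Quotient.exact (s := GenLoop.Homotopic.setoid N 1) ?_
    change cls (GenLoop.transAt i f GenLoop.const) = cls f
    rw [← cls_mul i]
    exact one_mul (cls f)
  have hg : GenLoop.Homotopic (GenLoop.transAt i GenLoop.const g) g := by
    refine Quotient.exact (s := GenLoop.Homotopic.setoid N 1) ?_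
    change cls (GenLoop.transAt i GenLoop.const g) = cls g
    rw [← cls_mul i]
    exact mul_one (cls g)
  refine Eq.trans ?_ (Quotient.sound (s := GenLoop.Homotopic.setoid N 1) (mulLoop_homotopic hf hg))
  change cls _ = cls _
  congr 1
  ext t
  change GenLoop.transAt i f g t =
    GenLoop.transAt i f GenLoop.const t * GenLoop.transAt i GenLoop.const g t
  rw [transAt_apply, transAt_apply, transAt_apply]
  split_ifs
  · exact (mul_one _).symm
  · exact (one_mul _).symm

end PointwiseProduct

/-! ### Polar decomposition in a nonunital C*-algebra. -/

section PolarDecomposition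

/-- A function that agrees with `t ↦ (1 - t)^(-1/2) - 1` for `t ≤ 1/2`. -/
def invSqrtDefect (t : ℝ) : ℝ := (√(1 - min t (1 / 2)))⁻¹ - 1

theorem invSqrtDefect_zero : invSqrtDefect 0 = 0 := by
  norm_num [invSqrtDefect]

@[fun_prop]
theorem continuous_invSqrtDefect : Continuous invSqrtDefect := by
  have h : ∀ t : ℝ, √(1 - min t (1 / 2)) ≠ 0 := fun t => by
    have := min_le_right t (1 / 2)
    exact (Real.sqrt_pos.2 (by linarith)).ne'
  exact ((by fun_prop : Continuous fun t : ℝ => √(1 - min t (1 / 2))).inv₀ h).sub continuous_const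

theorem invSqrtDefect_spec {t : ℝ} (ht : t ≤ 1 / 2) :
    invSqrtDefect t + invSqrtDefect t + invSqrtDefect t * invSqrtDefect t =
      t + t * (invSqrtDefect t + invSqrtDefect t + invSqrtDefect t * invSqrtDefect t) := by
  have h : 0 < 1 - t := by linarith
  have h1 : (√(1 - t))⁻¹ * (√(1 - t))⁻¹ * (1 - t) = 1 := by
    rw [← mul_inv, Real.mul_self_sqrt h.le, inv_mul_cancel₀ h.ne']
  rw [invSqrtDefect, min_eq_left ht]
  linear_combination h1

variable {B C : Type*} [NonUnitalCStarAlgebra B] [NonUnitalCStarAlgebra C]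

/-- The defect `a* + a - a* a` from `1 - a` being an isometry. -/
def leftDefect (a : B) : B := star a + a - star a * a

/-- The defect `a + a* - a a*` from `1 - a` being a coisometry. -/
def rightDefect (a : B) : B := a + star a - a * star a

@[fun_prop]
theorem continuous_leftDefect : Continuous (leftDefect : B → B) := by
  unfold leftDefect
  fun_prop

@[fun_prop]
theorem continuous_rightDefect : Continuous (rightDefect : B → B) := by
  unfold rightDefect
  fun_prop

theorem map_leftDefect (φ : B →⋆ₙₐ[ℂ] C) (a : B) : φ (leftDefect a) = leftDefect (φ a) := by
  simp [leftDefect, map_star]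

theorem map_rightDefect (φ : B →⋆ₙₐ[ℂ] C) (a : B) : φ (rightDefect a) = rightDefect (φ a) := by
  simp [rightDefect, map_star]

theorem isSelfAdjoint_leftDefect (a : B) : IsSelfAdjoint (leftDefect a) := by
  simp [leftDefect, IsSelfAdjoint, add_comm]

variable (B) in
/-- The elements whose defects have norm at most `1/2`. -/
def nearQuasiUnitary : Set B := {a | ‖leftDefect a‖ ≤ 1 / 2 ∧ ‖rightDefect a‖ ≤ 1 / 2}

/-- The unitary part in the polar decomposition of `1 - a`, as an element `1 - polar a`. -/
def polar (a : B) : B :=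
  a + a * cfcₙ invSqrtDefect (leftDefect a) - cfcₙ invSqrtDefect (leftDefect a)

theorem quasispectrum_leftDefect_subset {a : B} (ha : ‖leftDefect a‖ ≤ 1 / 2) :
    quasispectrum ℝ (leftDefect a) ⊆ Set.Icc (-(1 / 2)) (1 / 2) := fun t ht => by
  have h := NonUnitalIsometricContinuousFunctionalCalculus.norm_quasispectrum_le (leftDefect a) ht
    (isSelfAdjoint_leftDefect a)
  exact abs_le.1 (h.trans ha)

/-- All defects involved have quasispectrum in one compact interval, on which the functional
calculus depends continuously on the element. -/
theorem continuousOn_polar : ContinuousOn (polar : B → B) (nearQuasiUnitary B) := by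
  have h : ContinuousOn (fun a : B => cfcₙ invSqrtDefect (leftDefect a)) (nearQuasiUnitary B) :=
    ContinuousOn.cfcₙ' (s := Set.Icc (-(1 / 2) : ℝ) (1 / 2)) isCompact_Icc invSqrtDefect
      continuous_leftDefect.continuousOn (fun a ha => quasispectrum_leftDefect_subset ha.1)
      (fun a _ => isSelfAdjoint_leftDefect a) continuous_invSqrtDefect.continuousOn
      invSqrtDefect_zero
  exact (continuousOn_id.add (continuousOn_id.mul h)).sub h

/-- Functional calculus is natural. No norm bound on `a` is needed, since the truncation at `1/2`
makes `invSqrtDefect` continuous on the whole line. -/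
theorem map_polar (φ : B →⋆ₙₐ[ℂ] C) (a : B) : φ (polar a) = polar (φ a) := by
  have h : φ (cfcₙ invSqrtDefect (leftDefect a)) = cfcₙ invSqrtDefect (φ (leftDefect a)) :=
    NonUnitalStarAlgHomClass.map_cfcₙ (S := ℂ) φ invSqrtDefect (leftDefect a)
      continuous_invSqrtDefect.continuousOn invSqrtDefect_zero
      (NonUnitalStarAlgHom.instContinuousLinearMapClassComplex.map_continuous φ)
      (isSelfAdjoint_leftDefect a) (map_leftDefect φ a ▸ isSelfAdjoint_leftDefect (φ a))
  rw [polar, polar, map_sub, map_add, map_mul, h, map_leftDefect]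

theorem polar_eq_self {a : B} (ha : leftDefect a = 0) : polar a = a := by
  simp [polar, ha]

theorem isUnit_one_sub_inr {b : B} (hb : ‖b‖ ≤ 1 / 2) : IsUnit (1 - (b : Unitization ℂ B)) := by
  apply isUnit_one_sub_of_norm_lt_one
  rw [Unitization.norm_inr]
  linarith

theorem cfcₙ_invSqrtDefect_spec {h : B} (hsa : IsSelfAdjoint h)
    (hs : ∀ t ∈ quasispectrum ℝ h, t ≤ 1 / 2) :
    cfcₙ invSqrtDefect h + cfcₙ invSqrtDefect h + cfcₙ invSqrtDefect h * cfcₙ invSqrtDefect h =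
      h + h * (cfcₙ invSqrtDefect h + cfcₙ invSqrtDefect h +
        cfcₙ invSqrtDefect h * cfcₙ invSqrtDefect h) := by
  have hc : ∀ {f : ℝ → ℝ}, Continuous f → ContinuousOn f (quasispectrum ℝ h) :=
    fun hf => hf.continuousOn
  have h0 := invSqrtDefect_zero
  have hq := continuous_invSqrtDefect
  have e : cfcₙ (fun t => invSqrtDefect t + invSqrtDefect t + invSqrtDefect t * invSqrtDefect t) h
      = cfcₙ invSqrtDefect h + cfcₙ invSqrtDefect h +
        cfcₙ invSqrtDefect h * cfcₙ invSqrtDefect h := by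
    rw [cfcₙ_add (a := h) (fun t => invSqrtDefect t + invSqrtDefect t)
        (fun t => invSqrtDefect t * invSqrtDefect t) (hc (hq.add hq)) (by simp only [h0, add_zero])
        (hc (hq.mul hq)) (by simp only [h0, mul_zero]),
      cfcₙ_add (a := h) invSqrtDefect invSqrtDefect (hc hq) h0 (hc hq) h0,
      cfcₙ_mul invSqrtDefect invSqrtDefect h (hc hq) h0 (hc hq) h0]
  have e' := cfcₙ_add (a := h) (fun t : ℝ => t) (fun t => t *
      (invSqrtDefect t + invSqrtDefect t + invSqrtDefect t * invSqrtDefect t))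
    (hc continuous_id) rfl (hc (continuous_id.mul ((hq.add hq).add (hq.mul hq)))) (zero_mul _)
  rw [cfcₙ_mul (fun t : ℝ => t)
    (fun t => invSqrtDefect t + invSqrtDefect t + invSqrtDefect t * invSqrtDefect t) h
    (hc continuous_id) rfl (hc ((hq.add hq).add (hq.mul hq)))
    (by simp only [h0, add_zero, mul_zero]), e, cfcₙ_id' ℝ h hsa] at e'
  rw [← e', ← e]
  exact cfcₙ_congr fun t ht => invSqrtDefect_spec (hs t ht)

/-- In the unitization put `v = 1 - a` and `P = 1 + p`, so that `v*v = 1 - h` and `P` is its inverse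
square root. Then `1 - polar a = vP` is an isometry. It is unitary because `v` is invertible, and
this needs both defects to be small. -/
theorem polar_spec {a : B} (ha : a ∈ nearQuasiUnitary B) :
    rightDefect (polar a) = 0 ∧ leftDefect (polar a) = 0 := by
  set h := leftDefect a with hh
  set p := cfcₙ invSqrtDefect h with hp
  have hsa : IsSelfAdjoint h := isSelfAdjoint_leftDefect a
  have hpsa : star p = p := (cfcₙ_predicate (p := IsSelfAdjoint) invSqrtDefect h : IsSelfAdjoint p)
  have hcomm : Commute h p := by
    have := cfcₙ_commute_cfcₙ (id : ℝ → ℝ) invSqrtDefect h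
    rwa [cfcₙ_id ℝ h] at this
  have hspec : p + p + p * p = h + h * (p + p + p * p) :=
    cfcₙ_invSqrtDefect_spec hsa fun t ht => (quasispectrum_leftDefect_subset ha.1 ht).2
  set v : Unitization ℂ B := 1 - (a : Unitization ℂ B) with hv
  set P : Unitization ℂ B := 1 + (p : Unitization ℂ B) with hP
  have hvv : star v * v = 1 - (h : Unitization ℂ B) := by
    simp only [hv, hh, leftDefect, Unitization.inr_sub, Unitization.inr_add, Unitization.inr_mul,
      Unitization.inr_star, star_sub, star_one]
    noncomm_ring
  have hvv' : v * star v = 1 - Unitization.inr (R := ℂ) (rightDefect a) := by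
    simp only [hv, rightDefect, Unitization.inr_sub, Unitization.inr_add, Unitization.inr_mul,
      Unitization.inr_star, star_sub, star_one]
    noncomm_ring
  have hPs : star P = P := by
    rw [hP, star_add, star_one, ← Unitization.inr_star, hpsa]
  have hPc : Commute (1 - (h : Unitization ℂ B)) P := by
    have : Commute (h : Unitization ℂ B) (p : Unitization ℂ B) := by
      rw [commute_iff_eq, ← Unitization.inr_mul, ← Unitization.inr_mul, hcomm.eq]
    exact ((Commute.one_left _).sub_left ((Commute.one_right _).add_right this))
  have hPP : (1 - (h : Unitization ℂ B)) * (P * P) = 1 := by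
    have : (p : Unitization ℂ B) + p + p * p = h + h * (p + p + p * p) := by
      simpa only [Unitization.inr_add, Unitization.inr_mul] using
        congrArg (Unitization.inr : B → Unitization ℂ B) hspec
    have e : (1 - (h : Unitization ℂ B)) * (P * P) =
      1 + ((p : Unitization ℂ B) + p + p * p) - (h + h * (p + p + p * p)) := by
      rw [hP]; noncomm_ring
    rw [e, ← this, add_sub_cancel_right]
  have hPu : IsUnit P := by
    refine isUnit_iff_exists_and_exists.2 ⟨⟨P * (1 - h), ?_⟩, ⟨(1 - h) * P, ?_⟩⟩
    · rw [← mul_assoc, ← (hPc.mul_right hPc).eq, hPP]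
    · rw [mul_assoc, hPP]
  have hvu : IsUnit v := by
    obtain ⟨x, hx⟩ := isUnit_one_sub_inr ha.1
    obtain ⟨y, hy⟩ := isUnit_one_sub_inr ha.2
    refine isUnit_iff_exists_and_exists.2 ⟨⟨star v * ↑y⁻¹, ?_⟩, ⟨↑x⁻¹ * star v, ?_⟩⟩
    · rw [← mul_assoc, hvv', ← hy, Units.mul_inv]
    · rw [mul_assoc, hvv, hh, ← hx, Units.inv_mul]
  have hw : 1 - Unitization.inr (R := ℂ) (polar a) = v * P := by
    simp only [polar, Unitization.inr_sub, Unitization.inr_add, Unitization.inr_mul, hv, hP,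
      ← hh, ← hp]
    noncomm_ring
  have hww : star (v * P) * (v * P) = 1 := by
    rw [star_mul, hPs, mul_assoc, ← mul_assoc (star v), hvv, ← mul_assoc, ← hPc.eq, mul_assoc, hPP]
  have hww' : (v * P) * star (v * P) = 1 := by
    obtain ⟨w, hw'⟩ := hvu.mul hPu
    rw [← hw'] at hww ⊢
    rw [Units.eq_inv_of_mul_eq_one_right (u := w) hww, Units.mul_inv]
  rw [← hw] at hww hww'
  constructor
  · refine Unitization.inr_injective (R := ℂ) (sub_right_injective (b := 1) ?_)
    simp only [Unitization.inr_zero, sub_zero]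
    refine Eq.trans ?_ hww'
    simp only [rightDefect, Unitization.inr_sub, Unitization.inr_add, Unitization.inr_mul,
      Unitization.inr_star, star_sub, star_one]
    noncomm_ring
  · refine Unitization.inr_injective (R := ℂ) (sub_right_injective (b := 1) ?_)
    simp only [Unitization.inr_zero, sub_zero]
    refine Eq.trans ?_ hww
    simp only [leftDefect, Unitization.inr_sub, Unitization.inr_add, Unitization.inr_mul,
      Unitization.inr_star, star_sub, star_one]
    noncomm_ring

/-- From `u + u* = uu*` and the C*-identity, `‖u‖² ≤ 2‖u‖`. -/
theorem norm_quasiUnitary_le (u : QuasiUnitary B) : ‖u.1‖ ≤ 2 := by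
  have h : u.1 + star u.1 = u.1 * star u.1 := sub_eq_zero.1 u.2.1
  have h1 : ‖u.1‖ * ‖u.1‖ ≤ ‖u.1‖ + ‖u.1‖ := by
    rw [← CStarRing.norm_self_mul_star, ← h]
    exact (norm_add_le _ _).trans (by rw [norm_star])
  nlinarith [norm_nonneg u.1]

/-- The defects of `u` vanish. With `x = a - u` the left defect of `a` is `x* + x - x*a - u*x`, and
`‖a‖ ≤ 3`, `‖u‖ ≤ 2` give `η + η + 3η + 2η`; the right defect is alike. -/
theorem norm_defect_le (u : QuasiUnitary B) {a : B} {η : ℝ} (hη : η ≤ 1) (h : ‖a - u.1‖ ≤ η) :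
    ‖leftDefect a‖ ≤ 7 * η ∧ ‖rightDefect a‖ ≤ 7 * η := by
  have hu := norm_quasiUnitary_le u
  have h0 := norm_nonneg (a - u.1)
  have ha : ‖a‖ ≤ 3 := by
    have := norm_add_le (a - u.1) u.1
    rw [sub_add_cancel] at this
    linarith
  have hs : ‖star (a - u.1)‖ ≤ η := by rwa [norm_star]
  have key : ∀ x y : B, ‖x‖ ≤ η → ‖y‖ ≤ η → ∀ b c : B, ‖b‖ ≤ 3 → ‖c‖ ≤ 2 →
      ‖x + y - x * b - c * y‖ ≤ 7 * η := fun x y hx hy b c hb hc => by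
    have h1 := norm_mul_le x b
    have h2 := norm_mul_le c y
    have h3 : ‖x‖ * ‖b‖ ≤ η * 3 := mul_le_mul hx hb (norm_nonneg _) ((norm_nonneg _).trans hx)
    have h4 : ‖c‖ * ‖y‖ ≤ 2 * η := mul_le_mul hc hy (norm_nonneg _) (by norm_num)
    have h5 := norm_sub_le (x + y - x * b) (c * y)
    have h6 := norm_sub_le (x + y) (x * b)
    have h7 := norm_add_le x y
    linarith
  constructor
  · have := key (star (a - u.1)) (a - u.1) hs h a (star u.1) ha (by rwa [norm_star])
    convert this using 2
    have e : star a + a - star a * a = star (a - u.1) + (a - u.1) - star (a - u.1) * a -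
        star u.1 * (a - u.1) + (star u.1 + u.1 - star u.1 * u.1) := by
      rw [star_sub]
      noncomm_ring
    rw [leftDefect, e, u.2.2, add_zero]
  · have := key (a - u.1) (star (a - u.1)) h hs (star a) u.1 (by rwa [norm_star]) hu
    convert this using 2
    have e : a + star a - a * star a = a - u.1 + star (a - u.1) - (a - u.1) * star a -
        u.1 * star (a - u.1) + (u.1 + star u.1 - u.1 * star u.1) := by
      rw [star_sub]
      noncomm_ring
    rw [rightDefect, e, u.2.1, add_zero]

theorem mem_nearQuasiUnitary (u : QuasiUnitary B) {a : B} (h : ‖a - u.1‖ ≤ 1 / 14) :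
    a ∈ nearQuasiUnitary B := by
  obtain ⟨h1, h2⟩ := norm_defect_le u (by norm_num) h
  exact ⟨h1.trans (by norm_num), h2.trans (by norm_num)⟩

end PolarDecomposition

open scoped unitInterval

/-! ### Functoriality of the homotopy groups of quasi-unitaries. -/

section InducedMap

variable {N B C D : Type*} [DecidableEq N] [Nonempty N]
  [NonUnitalRing B] [StarRing B] [NonUnitalRing C] [StarRing C] [NonUnitalRing D] [StarRing D]
  [TopologicalSpace B] [IsTopologicalRing B] [ContinuousStar B]
  [TopologicalSpace C] [IsTopologicalRing C] [ContinuousStar C]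
  [TopologicalSpace D] [IsTopologicalRing D] [ContinuousStar D]

variable (N B) in
/-- The homotopy group of the component of `0` in the group of quasi-unitaries. -/
abbrev QuasiPi : Type _ :=
  HomotopyGroup N (QuasiUnitary.zeroComponent B) (1 : QuasiUnitary.zeroComponent B)

variable (N) in
/-- The homomorphism of homotopy groups of quasi-unitaries induced by a `*`-homomorphism. -/
def quasiPiMap (φ : B →⋆ₙ+* C) (hφ : Continuous φ) : QuasiPi N B →* QuasiPi N C :=
  homotopyMap N (QuasiUnitary.zeroComponentMap φ hφ) (QuasiUnitary.zeroComponentMap_one φ hφ)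

/-- The image of a loop of quasi-unitaries under a `*`-homomorphism. -/
abbrev quasiLoopMap (φ : B →⋆ₙ+* C) (hφ : Continuous φ)
    (f : GenLoop N (QuasiUnitary.zeroComponent B) 1) :
    GenLoop N (QuasiUnitary.zeroComponent C) 1 :=
  mapLoop (QuasiUnitary.zeroComponentMap φ hφ) (QuasiUnitary.zeroComponentMap_one φ hφ) f

omit [DecidableEq N] [Nonempty N] in
theorem genLoop_ext {f g : GenLoop N (QuasiUnitary.zeroComponent B) 1}
    (h : ∀ t, (f t).1.1 = (g t).1.1) : f = g :=
  GenLoop.ext _ _ fun t => Subtype.ext (Subtype.ext (h t))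

theorem quasiPiMap_comm {D' : Type*} [NonUnitalRing D'] [StarRing D']
    [TopologicalSpace D'] [IsTopologicalRing D'] [ContinuousStar D']
    {φ : B →⋆ₙ+* C} {ψ : C →⋆ₙ+* D} {φ' : B →⋆ₙ+* D'} {ψ' : D' →⋆ₙ+* D}
    (hφ : Continuous φ) (hψ : Continuous ψ) (hφ' : Continuous φ') (hψ' : Continuous ψ')
    (h : ∀ b, ψ (φ b) = ψ' (φ' b)) (α : QuasiPi N B) :
    quasiPiMap N ψ hψ (quasiPiMap N φ hφ α) = quasiPiMap N ψ' hψ' (quasiPiMap N φ' hφ' α) := by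
  obtain ⟨f⟩ := α
  exact congrArg cls (genLoop_ext fun t => h _)

theorem quasiPiMap_comp {φ : B →⋆ₙ+* C} {ψ : C →⋆ₙ+* D} {χ : B →⋆ₙ+* D}
    (hφ : Continuous φ) (hψ : Continuous ψ) (hχ : Continuous χ)
    (h : ∀ b, ψ (φ b) = χ b) (α : QuasiPi N B) :
    quasiPiMap N ψ hψ (quasiPiMap N φ hφ α) = quasiPiMap N χ hχ α := by
  obtain ⟨f⟩ := α
  exact congrArg cls (genLoop_ext fun t => h _)

theorem quasiPiMap_id {φ : B →⋆ₙ+* B} (hφ : Continuous φ) (h : ∀ b, φ b = b) (α : QuasiPi N B) :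
    quasiPiMap N φ hφ α = α := by
  obtain ⟨f⟩ := α
  exact congrArg cls (genLoop_ext fun t => h _)

/-- If `χ` is the sum of two `*`-homomorphisms with orthogonal ranges, then it induces the product
of the induced homomorphisms. -/
theorem quasiPiMap_mul_quasiPiMap {φ ψ χ : B →⋆ₙ+* C} (hφ : Continuous φ) (hψ : Continuous ψ)
    (hχ : Continuous χ) (hmul : ∀ a b, φ a * ψ b = 0) (hadd : ∀ b, φ b + ψ b = χ b)
    (α : QuasiPi N B) :
    quasiPiMap N φ hφ α * quasiPiMap N ψ hψ α = quasiPiMap N χ hχ α := by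
  obtain ⟨f⟩ := α
  change cls (quasiLoopMap φ hφ f) * cls (quasiLoopMap ψ hψ f) = cls (quasiLoopMap χ hχ f)
  rw [cls_mul_cls]
  refine congrArg cls (genLoop_ext fun t => ?_)
  change φ (f t).1.1 + ψ (f t).1.1 - φ (f t).1.1 * ψ (f t).1.1 = χ (f t).1.1
  -- Orthogonality removes the product term of the circle operation.
  rw [hmul, sub_zero, hadd]

end InducedMap

/-! ### Loops of quasi-unitaries in C*-algebras, and approximate lifting. -/

section CStar

variable {N B C : Type*} [DecidableEq N] [Nonempty N]
  [NonUnitalCStarAlgebra B] [NonUnitalCStarAlgebra C]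

theorem continuous_starAlgHom (φ : B →⋆ₙₐ[ℂ] C) : Continuous φ :=
  NonUnitalStarAlgHom.instContinuousLinearMapClassComplex.map_continuous φ

/-- The `*`-homomorphism of rings underlying a `*`-homomorphism of algebras. -/
def starRingHom (φ : B →⋆ₙₐ[ℂ] C) : B →⋆ₙ+* C where
  toFun := φ
  map_mul' := map_mul φ
  map_zero' := map_zero φ
  map_add' := map_add φ
  map_star' := map_star φ

theorem continuous_starRingHom (φ : B →⋆ₙₐ[ℂ] C) : Continuous (starRingHom φ) :=
  continuous_starAlgHom φ

variable {K : Type*} [TopologicalSpace K]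

theorem mem_zeroComponent_of_continuous [PathConnectedSpace K] (f : K → QuasiUnitary B)
    (hf : Continuous f) {k₀ : K} (h₀ : f k₀ = 1) (k : K) :
    f k ∈ QuasiUnitary.zeroComponent B := by
  have h := (PathConnectedSpace.joined k k₀).map hf
  rw [h₀] at h
  exact h

/-- A continuous family of quasi-unitaries. -/
def toQuasiUnitary (f : C(K, B)) (hf : ∀ k, rightDefect (f k) = 0 ∧ leftDefect (f k) = 0) :
    C(K, QuasiUnitary B) :=
  ⟨fun k => ⟨f k, hf k⟩, f.continuous.subtype_mk _⟩

/-- A continuous family of quasi-unitaries over a path connected space that contains `0` is a map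
to the component of `0`. -/
def toZeroComponent [PathConnectedSpace K] (f : C(K, B))
    (hf : ∀ k, rightDefect (f k) = 0 ∧ leftDefect (f k) = 0) (k₀ : K) (h₀ : f k₀ = 0) :
    C(K, QuasiUnitary.zeroComponent B) where
  toFun k := ⟨toQuasiUnitary f hf k, mem_zeroComponent_of_continuous _
    (toQuasiUnitary f hf).continuous (k₀ := k₀) (Subtype.ext h₀) k⟩
  continuous_toFun := (toQuasiUnitary f hf).continuous.subtype_mk _

theorem continuous_zeroComponent_val :
    Continuous fun u : QuasiUnitary.zeroComponent B => u.1.1 :=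
  Continuous.comp (g := fun u : QuasiUnitary B => u.1) continuous_subtype_val
    continuous_subtype_val

theorem continuous_zeroComponent_coe :
    Continuous fun u : QuasiUnitary.zeroComponent B => u.1 := continuous_subtype_val

omit [DecidableEq N] in
theorem cube_zero_mem_boundary : (0 : N → I) ∈ Cube.boundary N :=
  ⟨Classical.arbitrary N, Or.inl rfl⟩

instance : PathConnectedSpace I :=
  isPathConnected_iff_pathConnectedSpace.1
    ((convex_Icc (0 : ℝ) 1).isPathConnected ⟨0, by simp⟩)

omit [DecidableEq N] [Nonempty N] in
variable (N) in
theorem isClosed_cubeBoundary [Finite N] : IsClosed (Cube.boundary N) := by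
  have h : Cube.boundary N = ⋃ i, {t : N → I | t i = 0 ∨ t i = 1} := by
    ext t
    simp [Cube.boundary]
  rw [h]
  exact isClosed_iUnion_of_finite fun i =>
    (isClosed_eq (continuous_apply i) continuous_const).union
      (isClosed_eq (continuous_apply i) continuous_const)

/-- The loop in the component of `0` given by a continuous family of quasi-unitaries. -/
def quasiLoop (f : C(N → I, B)) (hf : ∀ t, rightDefect (f t) = 0 ∧ leftDefect (f t) = 0)
    (hb : ∀ t ∈ Cube.boundary N, f t = 0) : GenLoop N (QuasiUnitary.zeroComponent B) 1 :=
  ⟨toZeroComponent f hf 0 (hb 0 cube_zero_mem_boundary),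
    fun t ht => Subtype.ext (Subtype.ext (hb t ht))⟩

-- The homotopy only has to be given as a `B`-valued family: `I × (N → I)` is path connected and the
-- value `0` occurs, so it stays in the component of `0`.
omit [DecidableEq N] in
theorem cls_eq_of_homotopy {f g : GenLoop N (QuasiUnitary.zeroComponent B) 1}
    (H : C(I × (N → I), B)) (hH : ∀ x, rightDefect (H x) = 0 ∧ leftDefect (H x) = 0)
    (hb : ∀ s, ∀ t ∈ Cube.boundary N, H (s, t) = 0)
    (h0 : ∀ t, H (0, t) = (f t).1.1) (h1 : ∀ t, H (1, t) = (g t).1.1) : cls f = cls g := by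
  refine Quotient.sound (s := GenLoop.Homotopic.setoid N 1)
    ⟨⟨⟨toZeroComponent H hH (0, 0) (hb 0 0 cube_zero_mem_boundary), fun t => ?_, fun t => ?_⟩,
      fun s t ht => ?_⟩⟩
  · exact Subtype.ext (Subtype.ext (h0 t))
  · exact Subtype.ext (Subtype.ext (h1 t))
  · refine Eq.trans ?_ (f.2 t ht).symm
    exact Subtype.ext (Subtype.ext (hb s t ht))

/-- The composition of `polar` with a continuous family of nearly quasi-unitary elements. -/
def polarComp (F : C(K, B)) (hF : ∀ k, F k ∈ nearQuasiUnitary B) : C(K, B) where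
  toFun k := polar (F k)
  continuous_toFun := continuousOn_polar.comp_continuous F.continuous hF

theorem polar_zero : polar (0 : B) = 0 := polar_eq_self (by simp [leftDefect])

omit [DecidableEq N] in
/-- A loop is homotopic to the polar part of any nearby family. -/
theorem cls_eq_of_polar {f g : GenLoop N (QuasiUnitary.zeroComponent B) 1} (F : C(N → I, B))
    (hF : ∀ t ∈ Cube.boundary N, F t = 0) (hd : ∀ t, ‖F t - (f t).1.1‖ ≤ 1 / 14)
    (hg : ∀ t, polar (F t) = (g t).1.1) : cls f = cls g := by
  let f' : C(N → I, B) := ⟨fun t => (f t).1.1,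
    continuous_zeroComponent_val.comp f.1.continuous⟩
  let G : C(I × (N → I), B) :=
    -- The straight line from `f` to `F` stays within `1/14` of quasi-unitaries, where `polar` is
    -- defined well; `polar` turns it into a homotopy.
    ⟨fun x => f' x.2 + (x.1 : ℝ) • (F x.2 - f' x.2), by fun_prop⟩
  have hG : ∀ x, G x ∈ nearQuasiUnitary B := fun x => by
    refine mem_nearQuasiUnitary (f x.2).1 ?_
    change ‖(f x.2).1.1 + (x.1 : ℝ) • (F x.2 - (f x.2).1.1) - (f x.2).1.1‖ ≤ _
    rw [add_sub_cancel_left, norm_smul, Real.norm_of_nonneg x.1.2.1]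
    exact (mul_le_of_le_one_left (norm_nonneg _) x.1.2.2).trans (hd x.2)
  refine cls_eq_of_homotopy (polarComp G hG) (fun x => polar_spec (hG x)) (fun s t ht => ?_)
    (fun t => ?_) (fun t => ?_)
  · have h : f' t = 0 := congrArg (fun u => u.1.1) (f.2 t ht)
    change polar (f' t + (s : ℝ) • (F t - f' t)) = 0
    rw [hF t ht, h, sub_zero, smul_zero, add_zero, polar_zero]
  · change polar ((f t).1.1 + (0 : ℝ) • (F t - (f t).1.1)) = (f t).1.1
    rw [zero_smul, add_zero, polar_eq_self (f t).1.2.2]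
  · change polar ((f t).1.1 + (1 : ℝ) • (F t - (f t).1.1)) = (g t).1.1
    rw [one_smul, add_sub_cancel, hg]

/-- Continuous families can be lifted approximately along a surjective `*`-homomorphism, keeping
the value `0` on a closed set. -/
theorem exists_approx_lift [CompactSpace K] [T2Space K] {π : B →⋆ₙₐ[ℂ] C}
    (hπ : Function.Surjective π) (f : C(K, C)) {L : Set K} (hL : IsClosed L)
    (hf : ∀ k ∈ L, f k = 0) {η : ℝ} (hη : 0 < η) :
    ∃ F : C(K, B), ∀ k, ‖π (F k) - f k‖ < η ∧ (k ∈ L → F k = 0) := by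
  -- The constraints are convex, so a partition of unity glues locally constant choices: `0` near a
  -- point of `L`, where `f` is small, and a preimage of `f k` away from `L`.
  refine exists_continuous_forall_mem_convex_of_local_const
    (t := fun k => {b : B | ‖π b - f k‖ < η ∧ (k ∈ L → b = 0)}) (fun k => ?_) fun k => ?_
  · have h1 : Convex ℝ {b : B | ‖π b - f k‖ < η} := by
      have := (convex_ball (f k) η).linear_preimage ((π : B →ₗ[ℂ] C).restrictScalars ℝ)
      convert this using 1
      ext b
      simp [dist_eq_norm]
    have h2 : Convex ℝ {b : B | k ∈ L → b = 0} := by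
      intro a ha b hb s t _ _ _ hk
      rw [ha hk, hb hk, smul_zero, smul_zero, add_zero]
    exact h1.inter h2
  · by_cases hk : k ∈ L
    · have hc : ContinuousAt (fun y => ‖f y‖) k := by fun_prop
      have h := hc.eventually_lt_const (u := η) (by simpa [hf k hk] using hη)
      refine ⟨0, h.mono fun y hy => ⟨?_, fun _ => rfl⟩⟩
      simpa using hy
    · obtain ⟨b, hb⟩ := hπ (f k)
      have h : ∀ᶠ y in nhds k, ‖π b - f y‖ < η := by
        have hc : ContinuousAt (fun y => ‖π b - f y‖) k := by fun_prop
        refine hc.eventually_lt_const ?_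
        simpa [hb] using hη
      refine ⟨b, ?_⟩
      filter_upwards [h, hL.isOpen_compl.mem_nhds hk] with y hy hyL
      exact ⟨hy, fun h => absurd h hyL⟩

/-! ### Germ maps: lifting loops and null-homotopies. -/

/-- A surjective `*`-homomorphism `π` from `B` together with a downward directed family of
endomorphisms of `B` over `π`, which detect the norm of `π b` as small. -/
structure IsGermMap (π : B →⋆ₙₐ[ℂ] C) (𝓔 : Set (B →⋆ₙₐ[ℂ] B)) : Prop where
  surjective : Function.Surjective π
  nonempty : 𝓔.Nonempty
  map_eq : ∀ e ∈ 𝓔, ∀ b, π (e b) = π b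
  directed : ∀ e₁ ∈ 𝓔, ∀ e₂ ∈ 𝓔, ∃ e ∈ 𝓔, ∀ b, ‖e b‖ ≤ ‖e₁ b‖ ∧ ‖e b‖ ≤ ‖e₂ b‖
  small : ∀ ε : ℝ, 0 < ε → ∃ δ : ℝ, 0 < δ ∧ ∀ b, ‖π b‖ < δ → ∃ e ∈ 𝓔, ‖e b‖ < ε

namespace IsGermMap

variable {π : B →⋆ₙₐ[ℂ] C} {𝓔 : Set (B →⋆ₙₐ[ℂ] B)} (h : IsGermMap π 𝓔)
include h

/-- The pointwise choice of `e` works on a neighborhood; compactness leaves finitely many choices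
and directedness merges them. -/
theorem exists_forall_norm_lt [CompactSpace K] (D : C(K, B)) {ε : ℝ}
    (hD : ∀ k, ∃ e ∈ 𝓔, ‖e (D k)‖ < ε) : ∃ e ∈ 𝓔, ∀ k, ‖e (D k)‖ < ε := by
  have key : ∃ e ∈ 𝓔, ∀ k ∈ (Set.univ : Set K), ‖e (D k)‖ < ε := by
    refine isCompact_univ.induction_on (p := fun S => ∃ e ∈ 𝓔, ∀ k ∈ S, ‖e (D k)‖ < ε) ?_ ?_ ?_ ?_
    · obtain ⟨e, he⟩ := h.nonempty
      exact ⟨e, he, fun k hk => hk.elim⟩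
    · rintro S T hST ⟨e, he, hT⟩
      exact ⟨e, he, fun k hk => hT k (hST hk)⟩
    · rintro S T ⟨e, he, hS⟩ ⟨e', he', hT⟩
      obtain ⟨e'', he'', hle⟩ := h.directed e he e' he'
      refine ⟨e'', he'', fun k hk => ?_⟩
      rcases hk with hk | hk
      · exact (hle _).1.trans_lt (hS k hk)
      · exact (hle _).2.trans_lt (hT k hk)
    · intro k _
      obtain ⟨e, he, hk⟩ := hD k
      have hc : Continuous fun k => ‖e (D k)‖ :=
        ((continuous_starAlgHom e).comp D.continuous).norm
      exact ⟨{k | ‖e (D k)‖ < ε},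
        mem_nhdsWithin_of_mem_nhds ((isOpen_lt hc continuous_const).mem_nhds hk), e, he,
        fun k hk => hk⟩
  obtain ⟨e, he, hk⟩ := key
  exact ⟨e, he, fun k => hk k (Set.mem_univ k)⟩

/-- Continuous families of quasi-unitaries lift approximately to nearly quasi-unitary families. -/
theorem exists_lift [CompactSpace K] [T2Space K] (f : C(K, QuasiUnitary C)) {L : Set K}
    (hL : IsClosed L) (hf : ∀ k ∈ L, (f k).1 = 0) {ε : ℝ} (hε : 0 < ε) :
    ∃ F : C(K, B), (∀ k, F k ∈ nearQuasiUnitary B) ∧ (∀ k, ‖π (F k) - (f k).1‖ < ε) ∧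
      ∀ k ∈ L, F k = 0 := by
  obtain ⟨δ, hδ, hsmall⟩ := h.small (1 / 2) (by norm_num)
  -- `norm_defect_le` needs `η ≤ 1` and yields `7η`, which must stay below `δ`.
  let η := min ε (min 1 (δ / 8))
  have hη : 0 < η := by positivity
  have hη1 : η ≤ 1 := (min_le_right _ _).trans (min_le_left _ _)
  have hηδ : 7 * η < δ := by
    have : η ≤ δ / 8 := (min_le_right _ _).trans (min_le_right _ _)
    linarith
  obtain ⟨F, hF⟩ := exists_approx_lift h.surjective
    ⟨fun k => (f k).1, continuous_subtype_val.comp f.continuous⟩ hL hf hη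
  have hd := fun k => norm_defect_le (f k) hη1 (hF k).1.le
  obtain ⟨e₁, he₁, h₁⟩ := h.exists_forall_norm_lt
    (⟨fun k => leftDefect (F k), by fun_prop⟩ : C(K, B)) fun k => hsmall (leftDefect (F k)) (by
      rw [map_leftDefect]
      exact (hd k).1.trans_lt hηδ)
  obtain ⟨e₂, he₂, h₂⟩ := h.exists_forall_norm_lt
    (⟨fun k => rightDefect (F k), by fun_prop⟩ : C(K, B)) fun k => hsmall (rightDefect (F k)) (by
      rw [map_rightDefect]
      exact (hd k).2.trans_lt hηδ)
  obtain ⟨e, he, hle⟩ := h.directed e₁ he₁ e₂ he₂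
  -- The defects of `F` are small only after applying `π`. Replacing `F` by `e ∘ F` leaves `π ∘ F`
  -- unchanged and makes them small in `B`.
  refine ⟨⟨fun k => e (F k), (continuous_starAlgHom e).comp F.continuous⟩, fun k => ?_,
    fun k => ?_, fun k hk => ?_⟩
  · constructor
    · rw [ContinuousMap.coe_mk, ← map_leftDefect]
      exact (hle _).1.trans (h₁ k).le
    · rw [ContinuousMap.coe_mk, ← map_rightDefect]
      exact (hle _).2.trans (h₂ k).le
  · rw [ContinuousMap.coe_mk, h.map_eq e he]
    exact (hF k).1.trans_le (min_le_left _ _)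
  · rw [ContinuousMap.coe_mk, (hF k).2 hk, map_zero]

/-- The polar part of an approximate lift `F` is a genuine loop; by naturality its image is the
polar part of `π ∘ F`, which is homotopic to the given loop. -/
theorem quasiPiMap_surjective [Finite N] : Function.Surjective
    (quasiPiMap N (starRingHom π) (continuous_starRingHom π)) := by
  rintro ⟨f⟩
  obtain ⟨F, hF, hd, hb⟩ := h.exists_lift
    (⟨fun t => (f t).1, continuous_zeroComponent_coe.comp f.1.continuous⟩ : C(N → I, QuasiUnitary C))
    (L := Cube.boundary N) (isClosed_cubeBoundary N) (fun t ht => congrArg (fun u => u.1.1) (f.2 t ht))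
    (by norm_num : (0 : ℝ) < 1 / 14)
  refine ⟨cls (quasiLoop (polarComp F hF) (fun t => polar_spec (hF t)) fun t ht => ?_),
    (cls_eq_of_polar ⟨fun t => π (F t), (continuous_starAlgHom π).comp F.continuous⟩
      (fun t ht => ?_) (fun t => (hd t).le) fun t => ?_).symm⟩
  · change polar (F t) = 0
    rw [hb t ht, polar_zero]
  · rw [ContinuousMap.coe_mk, hb t ht, map_zero]
  · exact (map_polar π (F t)).symm

/-- A null-homotopy of `π ∘ f` is lifted approximately to `F`. Its initial face agrees with `f` only
approximately and only under `π`, but a suitable `e` brings `e ∘ F(0, ·)` within `1/14` of `e ∘ f`.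
The polar part of `e ∘ F` then contracts a loop homotopic to `e ∘ f`. -/
theorem exists_quasiPiMap_eq_cls_const [Finite N] {β : QuasiPi N B}
    (hβ : quasiPiMap N (starRingHom π) (continuous_starRingHom π) β =
      cls GenLoop.const) :
    ∃ e ∈ 𝓔, quasiPiMap N (starRingHom e) (continuous_starRingHom e) β =
      cls GenLoop.const := by
  obtain ⟨f⟩ := β
  obtain ⟨H⟩ : GenLoop.Homotopic
    (quasiLoopMap (starRingHom π) (continuous_starRingHom π) f) GenLoop.const :=
      Quotient.exact (s := GenLoop.Homotopic.setoid N 1) hβ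
  let H' : C(I × (N → I), QuasiUnitary C) :=
    ⟨fun x => (H x).1, continuous_zeroComponent_coe.comp H.continuous⟩
  -- The lift must vanish on the final face and the sides; the initial face is left free.
  let L : Set (I × (N → I)) := {x | x.1 = 1 ∨ x.2 ∈ Cube.boundary N}
  have hbd := isClosed_cubeBoundary N
  have hL : IsClosed L := (isClosed_eq continuous_fst continuous_const).union
    (hbd.preimage continuous_snd)
  have hHL : ∀ x ∈ L, (H' x).1 = 0 := by
    rintro ⟨s, t⟩ (rfl | ht)
    · exact congrArg (fun u => u.1.1) (H.apply_one t)
    · have h1 := H.eq_fst s ht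
      have h2 := (quasiLoopMap (starRingHom π) (continuous_starRingHom π) f).2 t ht
      exact congrArg (fun u => u.1.1) (h1.trans h2)
  obtain ⟨δ, hδ, hsmall⟩ := h.small (1 / 14) (by norm_num)
  obtain ⟨F, hF, hd, hb⟩ := h.exists_lift H' hL hHL hδ
  have hfc : Continuous fun t => (f t).1.1 :=
    continuous_zeroComponent_val.comp f.1.continuous
  obtain ⟨e, he, hle⟩ := h.exists_forall_norm_lt
    (⟨fun t => F (0, t) - (f t).1.1, by fun_prop⟩ : C(N → I, B)) fun t => hsmall _ (by
      have h0 : (H' (0, t)).1 = π (f t).1.1 := congrArg (fun u => u.1.1) (H.apply_zero t)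
      rw [ContinuousMap.coe_mk, map_sub, ← h0]
      exact hd (0, t))
  refine ⟨e, he, ?_⟩
  let F' : C(I × (N → I), B) := ⟨fun x => e (F x), (continuous_starAlgHom e).comp F.continuous⟩
  have hF' : ∀ x, F' x ∈ nearQuasiUnitary B := fun x => by
    constructor
    · change ‖leftDefect (e (F x))‖ ≤ _
      rw [← map_leftDefect]
      exact (NonUnitalStarAlgHom.norm_apply_le e _).trans (hF x).1
    · change ‖rightDefect (e (F x))‖ ≤ _
      rw [← map_rightDefect]
      exact (NonUnitalStarAlgHom.norm_apply_le e _).trans (hF x).2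
  have hF'L : ∀ x ∈ L, F' x = 0 := fun x hx => by
    change e (F x) = 0
    rw [hb x hx, map_zero]
  let F₀ : C(N → I, B) := ⟨fun t => F' (0, t), by fun_prop⟩
  let g : GenLoop N (QuasiUnitary.zeroComponent B) 1 :=
    quasiLoop (polarComp F₀ fun t => hF' (0, t)) (fun t => polar_spec (hF' (0, t))) fun t ht => by
      change polar (F' (0, t)) = 0
      rw [hF'L _ (Or.inr ht), polar_zero]
  have h1 : cls (quasiLoopMap (starRingHom e) (continuous_starRingHom e) f) = cls g := by
    refine cls_eq_of_polar F₀ (fun t ht => hF'L _ (Or.inr ht)) (fun t => ?_) fun t => rfl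
    have := (hle t).le
    rwa [ContinuousMap.coe_mk, map_sub] at this
  have h2 : cls g = cls GenLoop.const := by
    refine cls_eq_of_homotopy (polarComp F' hF') (fun x => polar_spec (hF' x)) (fun s t ht => ?_)
      (fun t => rfl) fun t => ?_
    · change polar (F' (s, t)) = 0
      rw [hF'L _ (Or.inr ht), polar_zero]
    · change polar (F' (1, t)) = 0
      rw [hF'L _ (Or.inl rfl), polar_zero]
  exact h1.trans h2

end IsGermMap

end CStar

open TopologicalSpace (Clopens)

/-! ### Characteristic functions of clopen sets. -/

section Cutoff

variable {X : Type*} [TopologicalSpace X]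

/-- The characteristic function of a clopen set. -/
def charFun (U : Clopens X) : C(X, ℂ) :=
  ⟨(U : Set X).indicator 1, continuous_one.indicator (by simp [U.isClopen.frontier_eq])⟩

theorem charFun_of_mem {U : Clopens X} {x : X} (h : x ∈ U) : charFun U x = 1 :=
  Set.indicator_of_mem (s := (U : Set X)) h 1

theorem charFun_of_notMem {U : Clopens X} {x : X} (h : x ∉ U) : charFun U x = 0 :=
  Set.indicator_of_notMem (s := (U : Set X)) h 1

theorem charFun_mul (U V : Clopens X) : charFun U * charFun V = charFun (U ⊓ V) := by
  ext x
  exact congrFun (Set.inter_indicator_one (s := (U : Set X)) (t := (V : Set X))).symm x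

theorem charFun_add {U V : Clopens X} (h : U ⊓ V = ⊥) :
    charFun U + charFun V = charFun (U ⊔ V) := by
  ext x
  have hd : Disjoint (U : Set X) V := by
    rw [Set.disjoint_iff_inter_eq_empty, ← Clopens.coe_inf, h, Clopens.coe_bot]
  exact congrFun (Set.indicator_union_of_disjoint hd (1 : X → ℂ)).symm x

theorem charFun_bot : charFun (⊥ : Clopens X) = 0 := by
  ext x
  exact charFun_of_notMem fun h => h

theorem charFun_top : charFun (⊤ : Clopens X) = 1 := by
  ext x
  exact charFun_of_mem trivial

theorem star_charFun (U : Clopens X) : star (charFun U) = charFun U := by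
  ext x
  change star (charFun U x) = charFun U x
  by_cases hU : x ∈ U
  · rw [charFun_of_mem hU, star_one]
  · rw [charFun_of_notMem hU, star_zero]

end Cutoff

/-! ### Cutoffs of a `C(X)`-algebra and the norm of its fibers. -/

namespace CXAlgebra

variable {X A : Type*} [TopologicalSpace X] [NonUnitalCStarAlgebra A] (E : CXAlgebra X A)

theorem act_act (f g : C(X, ℂ)) (a : A) : E.act f (E.act g a) = E.act (f * g) a := by
  rw [act, act, act, map_mul]
  rfl

theorem act_add (f g : C(X, ℂ)) (a : A) : E.act (f + g) a = E.act f a + E.act g a := by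
  rw [act, act, act, map_add]
  rfl

theorem act_one (a : A) : E.act 1 a = a := by
  rw [act, map_one]
  rfl

theorem act_zero (a : A) : E.act 0 a = 0 := by
  rw [act, map_zero]
  rfl

theorem norm_act_le [CompactSpace X] (f : C(X, ℂ)) (a : A) : ‖E.act f a‖ ≤ ‖f‖ * ‖a‖ := by
  refine ((E.θ f).fst.le_opNorm a).trans (mul_le_mul_of_nonneg_right ?_ (norm_nonneg a))
  rw [DoubleCentralizer.norm_fst]
  exact NonUnitalStarAlgHom.norm_apply_le E.θ f

/-- Multiplication by the characteristic function of a clopen set. -/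
def cutoff (U : Clopens X) : A →⋆ₙₐ[ℂ] A where
  toFun := E.act (charFun U)
  map_smul' c a := map_smul _ c a
  map_zero' := map_zero _
  map_add' := map_add _
  map_mul' a b := by
    rw [act_mul, mul_act, act_act, charFun_mul, inf_idem]
  map_star' a := by
    rw [star_act, star_charFun]

theorem cutoff_apply (U : Clopens X) (a : A) : E.cutoff U a = E.act (charFun U) a := rfl

theorem cutoff_cutoff (U V : Clopens X) (a : A) :
    E.cutoff U (E.cutoff V a) = E.cutoff (U ⊓ V) a := by
  rw [cutoff_apply, cutoff_apply, cutoff_apply, act_act, charFun_mul]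

theorem cutoff_add {U V : Clopens X} (h : U ⊓ V = ⊥) (a : A) :
    E.cutoff U a + E.cutoff V a = E.cutoff (U ⊔ V) a := by
  rw [cutoff_apply, cutoff_apply, cutoff_apply, ← act_add, charFun_add h]

theorem cutoff_mul {U V : Clopens X} (h : U ⊓ V = ⊥) (a b : A) :
    E.cutoff U a * E.cutoff V b = 0 := by
  rw [cutoff_apply, cutoff_apply, act_mul, mul_act, act_act, charFun_mul, h, charFun_bot, act_zero]

theorem cutoff_top (a : A) : E.cutoff ⊤ a = a := by
  rw [cutoff_apply, charFun_top, act_one]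

theorem norm_cutoff_le (U : Clopens X) (a : A) : ‖E.cutoff U a‖ ≤ ‖a‖ :=
  NonUnitalStarAlgHom.norm_apply_le _ _

theorem π_cutoff {U : Clopens X} {x : X} (hx : x ∈ U) (a : A) :
    E.π {x} (E.cutoff U a) = E.π {x} a := by
  refine (Submodule.Quotient.eq _).2 ?_
  have h : E.cutoff U a - a = E.act (charFun U - 1) a := by
    rw [sub_eq_iff_eq_add]
    conv_rhs => rw [← E.act_one a, act_act, mul_one, ← act_add, sub_add_cancel]
    rfl
  rw [h]
  refine E.act_mem_ideal (fun y hy => ?_) a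
  rw [Set.mem_singleton_iff.1 hy]
  change charFun U x - 1 = 0
  rw [charFun_of_mem hx, sub_self]

variable [CompactSpace X] [T2Space X]

/-- For a generator `f a` with `f x = 0`, take a clopen neighborhood on which `f` is small. Sums are
handled by intersecting neighborhoods, and limits by the contractivity of cutoffs. -/
theorem exists_norm_cutoff_lt_of_mem_ideal (hX : coveringDim X = 0) {x : X} {a : A}
    (ha : a ∈ E.ideal {x}) {ε : ℝ} (hε : 0 < ε) : ∃ U : Clopens X, x ∈ U ∧ ‖E.cutoff U a‖ < ε := by
  obtain ⟨b, hb, hab⟩ := Metric.mem_closure_iff.1 ha (ε / 2) (half_pos hε)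
  suffices H : ∀ ε : ℝ, 0 < ε → ∃ U : Clopens X, x ∈ U ∧ ‖E.cutoff U b‖ < ε by
    obtain ⟨U, hxU, hU⟩ := H (ε / 2) (half_pos hε)
    refine ⟨U, hxU, ?_⟩
    have h1 : ‖E.cutoff U (a - b)‖ < ε / 2 :=
      (E.norm_cutoff_le U _).trans_lt (by rwa [← dist_eq_norm])
    have h2 := norm_add_le (E.cutoff U (a - b)) (E.cutoff U b)
    rw [← map_add, sub_add_cancel] at h2
    linarith
  clear ha hab
  induction hb using Submodule.span_induction with
  | mem b hb =>
    obtain ⟨f, hf, a, rfl⟩ := hb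
    intro ε hε
    let δ := ε / (‖a‖ + 1)
    have hδ : 0 < δ := by positivity
    obtain ⟨U, hU, hxU, hUf⟩ := exists_isClopen_subset_of_coveringDim_eq_zero hX
      (W := {y | ‖f y‖ < δ}) (isOpen_lt (by fun_prop) continuous_const) (x := x)
      (by simpa [hf x rfl] using hδ)
    refine ⟨⟨U, hU⟩, hxU, ?_⟩
    rw [cutoff_apply, act_act]
    have hn : ‖charFun ⟨U, hU⟩ * f‖ ≤ δ := by
      refine (ContinuousMap.norm_le _ hδ.le).2 fun y => ?_
      change ‖charFun ⟨U, hU⟩ y * f y‖ ≤ δ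
      by_cases hy : y ∈ (⟨U, hU⟩ : Clopens X)
      · rw [charFun_of_mem hy, one_mul]
        exact (hUf hy).le
      · rw [charFun_of_notMem hy, zero_mul, norm_zero]
        exact hδ.le
    calc _ ≤ δ * ‖a‖ := (E.norm_act_le _ a).trans
            (mul_le_mul_of_nonneg_right hn (norm_nonneg a))
      _ < δ * (‖a‖ + 1) := by gcongr; linarith
      _ = ε := div_mul_cancel₀ _ (by positivity)
  | zero => exact fun ε hε => ⟨⊤, trivial, by rwa [map_zero, norm_zero]⟩
  | add b c _ _ hb hc =>
    intro ε hε
    obtain ⟨U, hxU, hU⟩ := hb (ε / 2) (half_pos hε)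
    obtain ⟨V, hxV, hV⟩ := hc (ε / 2) (half_pos hε)
    refine ⟨U ⊓ V, ⟨hxU, hxV⟩, ?_⟩
    rw [map_add]
    have h1 : ‖E.cutoff (U ⊓ V) b‖ ≤ ‖E.cutoff U b‖ := by
      rw [inf_comm, ← cutoff_cutoff]
      exact E.norm_cutoff_le _ _
    have h2 : ‖E.cutoff (U ⊓ V) c‖ ≤ ‖E.cutoff V c‖ := by
      rw [← cutoff_cutoff]
      exact E.norm_cutoff_le _ _
    have := norm_add_le (E.cutoff (U ⊓ V) b) (E.cutoff (U ⊓ V) c)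
    linarith
  | smul c b _ hb =>
    intro ε hε
    obtain ⟨U, hxU, hU⟩ := hb (ε / (‖c‖ + 1)) (by positivity)
    refine ⟨U, hxU, ?_⟩
    rw [map_smul, norm_smul]
    calc _ ≤ ‖c‖ * (ε / (‖c‖ + 1)) := by gcongr
      _ < (‖c‖ + 1) * (ε / (‖c‖ + 1)) := by gcongr; linarith
      _ = ε := mul_div_cancel₀ _ (by positivity)

/-- The norm in a fiber is the infimum of the norms over clopen neighborhoods. -/
theorem exists_norm_cutoff_lt (hX : coveringDim X = 0) {x : X} {a : A} {c : ℝ}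
    (h : ‖E.π {x} a‖ < c) : ∃ U : Clopens X, x ∈ U ∧ ‖E.cutoff U a‖ < c := by
  -- Half of the gap below `c` goes to a near-optimal lift `b` of `a(x)`, the other half to cutting
  -- off `a - b`, which lies in the ideal.
  obtain ⟨b, hb, hbc⟩ := Restriction.exists_π_eq E {x} (E.π {x} a)
    (ε := (c - ‖E.π {x} a‖) / 2) (by linarith)
  have hab : a - b ∈ E.ideal {x} := (Submodule.Quotient.eq _).1 hb.symm
  obtain ⟨U, hxU, hU⟩ := E.exists_norm_cutoff_lt_of_mem_ideal hX hab
    (ε := (c - ‖E.π {x} a‖) / 2) (by linarith)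
  refine ⟨U, hxU, ?_⟩
  have h1 := norm_add_le (E.cutoff U (a - b)) (E.cutoff U b)
  rw [← map_add, sub_add_cancel] at h1
  have h2 := E.norm_cutoff_le U b
  linarith

/-- The norm formula transfers the C*-identity from `A`: `‖a(x)‖² ≤ ‖χ_U a‖² = ‖χ_U a*a‖`, and the
last norm can be brought arbitrarily close to `‖(a*a)(x)‖`. -/
theorem cstarRing_fiber (hX : coveringDim X = 0) (x : X) : CStarRing (E.Fiber x) where
  norm_mul_self_le b := by
    obtain ⟨a, rfl⟩ := Restriction.π_surjective E {x} b
    refine le_of_forall_gt_imp_ge_of_dense fun c hc => ?_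
    rw [← Restriction.π_star, ← Restriction.π_mul] at hc
    obtain ⟨U, hxU, hU⟩ := E.exists_norm_cutoff_lt hX hc
    rw [map_mul, map_star, CStarRing.norm_star_mul_self] at hU
    rw [← E.π_cutoff hxU a]
    have := Restriction.norm_π_le E {x} (E.cutoff U a)
    exact (mul_le_mul this this (norm_nonneg _) (norm_nonneg _)).trans hU.le

/-- The fibers of a `C(X)`-algebra over a zero-dimensional space are C*-algebras. -/
@[reducible]
def fiberCStarAlgebra (hX : coveringDim X = 0) (x : X) : NonUnitalCStarAlgebra (E.Fiber x) where
  __ := (inferInstance : NonUnitalNormedRing (E.Fiber x))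
  __ := (inferInstance : StarRing (E.Fiber x))
  __ := (inferInstance : CompleteSpace (E.Fiber x))
  __ := (inferInstance : NormedSpace ℂ (E.Fiber x))
  __ := E.cstarRing_fiber hX x
  smul_assoc c a b := by
    obtain ⟨a, rfl⟩ := Restriction.π_surjective E {x} a
    obtain ⟨b, rfl⟩ := Restriction.π_surjective E {x} b
    exact congrArg (E.π {x}) (smul_mul_assoc c a b)
  smul_comm c a b := by
    obtain ⟨a, rfl⟩ := Restriction.π_surjective E {x} a
    obtain ⟨b, rfl⟩ := Restriction.π_surjective E {x} b
    exact congrArg (E.π {x}) (mul_smul_comm c a b).symm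
  star_smul c a := by
    obtain ⟨a, rfl⟩ := Restriction.π_surjective E {x} a
    exact congrArg (E.π {x}) (star_smul c a)

/-- The quotient map onto a fiber. -/
def πRingHom (x : X) : A →⋆ₙ+* E.Fiber x where
  toFun := E.π {x}
  map_mul' := Restriction.π_mul E {x}
  map_zero' := rfl
  map_add' := Restriction.π_add E {x}
  map_star' := Restriction.π_star E {x}

/-- The quotient map onto a fiber, as a `*`-homomorphism of C*-algebras. -/
def πHom (hX : coveringDim X = 0) (x : X) :
    letI := E.fiberCStarAlgebra hX x
    A →⋆ₙₐ[ℂ] E.Fiber x :=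
  letI := E.fiberCStarAlgebra hX x
  { toFun := E.π {x}
    map_smul' := fun _ _ => rfl
    map_mul' := Restriction.π_mul E {x}
    map_zero' := rfl
    map_add' := Restriction.π_add E {x}
    map_star' := Restriction.π_star E {x} }

end CXAlgebra

/-! ### Entrywise smallness of matrices. -/

section Matrix

/-- A small matrix over a C*-algebra is one with small entries. -/
theorem exists_norm_lt_of_entries {n A : Type*} [Fintype n] [NonUnitalCStarAlgebra A]
    [PartialOrder A] [StarOrderedRing A] {ε : ℝ} (hε : 0 < ε) :
    ∃ δ : ℝ, 0 < δ ∧ ∀ M : CStarMatrix n n A, (∀ i j, ‖M i j‖ < δ) → ‖M‖ < ε := by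
  have hc : Continuous fun M : n → n → A => (CStarMatrix.ofMatrix (Matrix.of M)) :=
    (CStarMatrix.ofMatrixL (m := n) (n := n) (A := A)).continuous
  have h0 : ‖(CStarMatrix.ofMatrix (Matrix.of (0 : n → n → A)) : CStarMatrix n n A)‖ < ε := by
    have : (CStarMatrix.ofMatrix (Matrix.of (0 : n → n → A)) : CStarMatrix n n A) = 0 := rfl
    rwa [this, norm_zero]
  obtain ⟨δ, hδ, h⟩ := Metric.eventually_nhds_iff.1
    (hc.norm.continuousAt.eventually_lt_const h0)
  refine ⟨δ, hδ, fun M hM => h (y := fun i j => M i j) ?_⟩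
  rw [dist_zero_right]
  exact (pi_norm_lt_iff hδ).2 fun i => (pi_norm_lt_iff hδ).2 fun j => hM i j

end Matrix

/-! ### Patching over clopen sets. -/

/-- Patching over a compact space: a property of clopen sets that passes to clopen subsets and to
disjoint unions, and holds locally, holds for the whole space. -/
theorem clopens_top_of_local {X : Type*} [TopologicalSpace X] [CompactSpace X]
    {p : Clopens X → Prop} (hbot : p ⊥) (hmono : ∀ U V, p U → p (V ⊓ U))
    (hsup : ∀ U V, U ⊓ V = ⊥ → p U → p V → p (U ⊔ V)) (hloc : ∀ x, ∃ U, x ∈ U ∧ p U) : p ⊤ := by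
  have key : ∃ U : Clopens X, (Set.univ : Set X) ⊆ (U : Set X) ∧ p U := by
    refine isCompact_univ.induction_on (p := fun S => ∃ U : Clopens X, S ⊆ (U : Set X) ∧ p U) ?_ ?_ ?_ ?_
    · exact ⟨⊥, Set.empty_subset _, hbot⟩
    · rintro S T hST ⟨U, hTU, hU⟩
      exact ⟨U, hST.trans hTU, hU⟩
    · rintro S T ⟨U, hSU, hU⟩ ⟨V, hTV, hV⟩
      -- `V` is shrunk to its part outside `U`, which makes the union disjoint.
      refine ⟨U ⊔ Uᶜ ⊓ V, ?_, hsup _ _ ?_ hU (hmono _ _ hV)⟩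
      · rw [sup_inf_left, sup_compl_eq_top, top_inf_eq, Clopens.coe_sup]
        exact Set.union_subset_union hSU hTV
      · rw [← inf_assoc, inf_compl_eq_bot, bot_inf_eq]
    · intro x _
      obtain ⟨U, hxU, hU⟩ := hloc x
      exact ⟨U, mem_nhdsWithin_of_mem_nhds (U.isClopen.isOpen.mem_nhds hxU), U, subset_rfl, hU⟩
  obtain ⟨U, hU, hp⟩ := key
  obtain rfl : U = ⊤ := SetLike.coe_injective (Set.univ_subset_iff.1 hU)
  exact hp

/-- A family of cutoff endomorphisms of a commutative group, indexed by the clopen sets. -/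
structure IsCutoffFamily {X P : Type*} [TopologicalSpace X] [CommGroup P]
    (c : Clopens X → P →* P) : Prop where
  comp : ∀ U V a, c U (c V a) = c (U ⊓ V) a
  mul : ∀ U V, U ⊓ V = ⊥ → ∀ a, c U a * c V a = c (U ⊔ V) a
  top : ∀ a, c ⊤ a = a

namespace IsCutoffFamily

variable {X P Q : Type*} [TopologicalSpace X] [CompactSpace X] [CommGroup P] [CommGroup Q]
  {c : Clopens X → P →* P} {d : Clopens X → Q →* Q}

omit [CompactSpace X] in
theorem bot (hc : IsCutoffFamily c) (a : P) : c ⊥ a = 1 := by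
  have h := hc.mul ⊥ ⊥ (inf_idem _) a
  rw [sup_idem] at h
  exact mul_eq_left.1 h

/-- An element that is locally torsion is torsion. -/
theorem exists_pow_eq_one (hc : IsCutoffFamily c) (a : P)
    (h : ∀ x : X, ∃ U : Clopens X, x ∈ U ∧ ∃ k : ℕ, 0 < k ∧ c U a ^ k = 1) :
    ∃ k : ℕ, 0 < k ∧ a ^ k = 1 := by
  have := clopens_top_of_local (p := fun U => ∃ k : ℕ, 0 < k ∧ c U a ^ k = 1)
    ⟨1, one_pos, by rw [hc.bot, one_pow]⟩ ?_ ?_ h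
  · simpa only [hc.top] using this
  · rintro U V ⟨k, hk, h⟩
    exact ⟨k, hk, by rw [← hc.comp, ← map_pow, h, map_one]⟩
  · rintro U V hUV ⟨k, hk, hU⟩ ⟨l, hl, hV⟩
    refine ⟨k * l, Nat.mul_pos hk hl, ?_⟩
    rw [← hc.mul U V hUV, mul_pow, pow_mul, hU, mul_comm k l, pow_mul, hV, one_pow, one_pow,
      one_mul]

/-- An element with a power that locally lies in the range of `φ` has a power in the range of `φ`. -/
theorem exists_map_eq_pow (hd : IsCutoffFamily d) (φ : P →* Q)
    (hcd : ∀ U a, φ (c U a) = d U (φ a)) (b : Q)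
    (h : ∀ x : X, ∃ U : Clopens X, x ∈ U ∧ ∃ k : ℕ, 0 < k ∧ ∃ a, φ a = d U b ^ k) :
    ∃ k : ℕ, 0 < k ∧ ∃ a, φ a = b ^ k := by
  have := clopens_top_of_local (p := fun U => ∃ k : ℕ, 0 < k ∧ ∃ a, φ a = d U b ^ k)
    ⟨1, one_pos, 1, by rw [hd.bot, one_pow, map_one]⟩ ?_ ?_ h
  · simpa only [hd.top] using this
  · rintro U V ⟨k, hk, a, h⟩
    exact ⟨k, hk, c V a, by rw [hcd, h, map_pow, hd.comp]⟩
  · rintro U V hUV ⟨k, hk, a, hU⟩ ⟨l, hl, a', hV⟩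
    -- The powers `l` and `k` bring both local solutions to the common exponent `k * l`.
    refine ⟨k * l, Nat.mul_pos hk hl, a ^ l * a' ^ k, ?_⟩
    rw [map_mul, map_pow, map_pow, hU, hV, ← hd.mul U V hUV, mul_pow, pow_mul, mul_comm k l,
      pow_mul]

end IsCutoffFamily

/-! ### Matrix algebras over the fibers, and the conclusion. -/

section Matrix

variable {n : Type*} [Fintype n]

/-- Entrywise application of a `*`-homomorphism to matrices. -/
def matrixMap (n : Type*) [Fintype n] {B C : Type*} [NonUnitalRing B] [StarRing B]
    [NonUnitalRing C] [StarRing C] (φ : B →⋆ₙ+* C) : Matrix n n B →⋆ₙ+* Matrix n n C where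
  toFun M := M.map φ
  map_mul' M M' := by
    ext i j
    simp [Matrix.mul_apply]
  map_zero' := by
    ext i j
    simp
  map_add' M M' := by
    ext i j
    simp
  map_star' M := by
    ext i j
    simp [Matrix.star_apply, map_star]

theorem continuous_matrixMap {B C : Type*} [NonUnitalRing B] [StarRing B]
    [NonUnitalRing C] [StarRing C] [TopologicalSpace B] [TopologicalSpace C] {φ : B →⋆ₙ+* C}
    (hφ : Continuous φ) : Continuous (matrixMap n φ) :=
  continuous_id.matrix_map hφ

theorem matrixMap_cornerInclusion {B C : Type*} [NonUnitalRing B] [StarRing B]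
    [NonUnitalRing C] [StarRing C] (φ : B →⋆ₙ+* C) (n : ℕ) (M : Matrix (Fin n) (Fin n) B) :
    matrixMap (Fin (n + 1)) φ (cornerInclusion n B M) =
      cornerInclusion n C (matrixMap (Fin n) φ M) := by
  change ((Matrix.fromBlocks M 0 0 (0 : Matrix (Fin 1) (Fin 1) B)).submatrix
      finSumFinEquiv.symm finSumFinEquiv.symm).map φ =
    (Matrix.fromBlocks (M.map φ) 0 0 (0 : Matrix (Fin 1) (Fin 1) C)).submatrix
      finSumFinEquiv.symm finSumFinEquiv.symm
  rw [← Matrix.submatrix_map, Matrix.fromBlocks_map]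
  simp

theorem ratNonstableKMap_bijective_iff {B C : Type*} [NonUnitalRing B] [StarRing B]
    [NonUnitalRing C] [StarRing C]
    [TopologicalSpace B] [IsTopologicalRing B] [ContinuousStar B]
    [TopologicalSpace C] [IsTopologicalRing C] [ContinuousStar C]
    (m : ℕ) [NeZero m] (φ : B →⋆ₙ+* C) (hφ : Continuous φ) :
    Function.Bijective (ratNonstableKMap m φ hφ) ↔
      (∀ a, quasiPiMap (Fin m) φ hφ a = 1 → ∃ k : ℕ, 0 < k ∧ a ^ k = 1) ∧
        ∀ b, ∃ k : ℕ, 0 < k ∧ ∃ a, quasiPiMap (Fin m) φ hφ a = b ^ k :=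
  rTensor_rat_bijective_iff _

namespace CXAlgebra

variable {X A : Type*} [TopologicalSpace X] [CompactSpace X] [T2Space X]
  [NonUnitalCStarAlgebra A] (E : CXAlgebra X A)

omit [CompactSpace X] [T2Space X] in
theorem continuous_πRingHom (x : X) : Continuous (E.πRingHom x) :=
  AddMonoidHomClass.continuous_of_bound (E.πRingHom x) 1 fun a => by
    rw [one_mul]
    exact Restriction.norm_π_le E {x} a

/-- The endomorphism of the homotopy group of a matrix algebra given by a cutoff. -/
def cutoffPi (m n : ℕ) [NeZero m] (U : Clopens X) :
    QuasiPi (Fin m) (Matrix (Fin n) (Fin n) A) →* QuasiPi (Fin m) (Matrix (Fin n) (Fin n) A) :=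
  quasiPiMap (Fin m) (matrixMap (Fin n) (starRingHom (E.cutoff U)))
    (continuous_matrixMap (continuous_starRingHom (E.cutoff U)))

/-- The evaluation at a point on the homotopy group of a matrix algebra. -/
def evalPi (m n : ℕ) [NeZero m] (x : X) :
    QuasiPi (Fin m) (Matrix (Fin n) (Fin n) A) →*
      QuasiPi (Fin m) (Matrix (Fin n) (Fin n) (E.Fiber x)) :=
  quasiPiMap (Fin m) (matrixMap (Fin n) (E.πRingHom x))
    (continuous_matrixMap (E.continuous_πRingHom x))

omit [CompactSpace X] [T2Space X] in
theorem isCutoffFamily_cutoffPi (m n : ℕ) [NeZero m] : IsCutoffFamily (E.cutoffPi m n) where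
  comp U V a := quasiPiMap_comp _ _ _ (fun M => by
    ext i j
    exact E.cutoff_cutoff U V (M i j)) a
  mul U V h a := quasiPiMap_mul_quasiPiMap _ _ _ (fun M M' => by
    ext i j
    rw [Matrix.mul_apply]
    exact Finset.sum_eq_zero fun k _ => E.cutoff_mul h (M i k) (M' k j)) (fun M => by
    ext i j
    exact E.cutoff_add h (M i j)) a
  top a := quasiPiMap_id _ (fun M => by
    ext i j
    exact E.cutoff_top (M i j)) a

/-- A matrix has finitely many entries, so the norm formula in `A` gives one clopen neighborhood on
which all of them are small. -/
theorem isGermMap [PartialOrder A] [StarOrderedRing A] (hX : coveringDim X = 0) (x : X) :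
    letI := E.fiberCStarAlgebra hX x
    letI := CStarAlgebra.spectralOrder (E.Fiber x)
    haveI := CStarAlgebra.spectralOrderedRing (E.Fiber x)
    IsGermMap (CStarMatrix.mapₙₐ (n := n) (E.πHom hX x))
      {e | ∃ U : Clopens X, x ∈ U ∧ e = CStarMatrix.mapₙₐ (E.cutoff U)} := by
  let _ := E.fiberCStarAlgebra hX x
  let _ := CStarAlgebra.spectralOrder (E.Fiber x)
  have _ := CStarAlgebra.spectralOrderedRing (E.Fiber x)
  have hle : ∀ (U V : Clopens X) (M : CStarMatrix n n A),
      ‖CStarMatrix.mapₙₐ (E.cutoff (U ⊓ V)) M‖ ≤ ‖CStarMatrix.mapₙₐ (E.cutoff V) M‖ :=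
    fun U V M => by
      have : CStarMatrix.mapₙₐ (E.cutoff (U ⊓ V)) M =
          CStarMatrix.mapₙₐ (E.cutoff U) (CStarMatrix.mapₙₐ (E.cutoff V) M) := by
        ext i j
        exact (E.cutoff_cutoff U V (M i j)).symm
      rw [this]
      exact NonUnitalStarAlgHom.norm_apply_le _ _
  refine ⟨fun M => ?_, ⟨_, ⊤, trivial, rfl⟩, ?_, ?_, fun ε hε => ?_⟩
  · choose s hs using Restriction.π_surjective E {x}
    refine ⟨CStarMatrix.ofMatrix (Matrix.of fun i j => s (M i j)), ?_⟩
    ext i j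
    exact hs (M i j)
  · rintro _ ⟨U, hxU, rfl⟩ M
    ext i j
    exact E.π_cutoff hxU (M i j)
  · rintro _ ⟨U, hxU, rfl⟩ _ ⟨V, hxV, rfl⟩
    refine ⟨_, ⟨U ⊓ V, ⟨hxU, hxV⟩, rfl⟩, fun M => ⟨?_, hle U V M⟩⟩
    rw [inf_comm]
    exact hle V U M
  · obtain ⟨δ, hδ, h⟩ := exists_norm_lt_of_entries (n := n) (A := A) hε
    refine ⟨δ, hδ, fun M hM => ?_⟩
    have hij : ∀ i j, ∃ U : Clopens X, x ∈ U ∧ ‖E.cutoff U (M i j)‖ < δ := fun i j =>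
      E.exists_norm_cutoff_lt hX
        ((CStarMatrix.norm_entry_le_norm (M := CStarMatrix.mapₙₐ (E.πHom hX x) M)
          (i := i) (j := j)).trans_lt hM)
    choose U hxU hU using hij
    let V : Clopens X := Finset.univ.inf fun p : n × n => U p.1 p.2
    have hxV : x ∈ V := Finset.inf_induction (p := fun W : Clopens X => x ∈ W) trivial
      (fun _ h₁ _ h₂ => ⟨h₁, h₂⟩) fun p _ => hxU p.1 p.2
    refine ⟨_, ⟨V, hxV, rfl⟩, h _ fun i j => ?_⟩
    have hV : V = V ⊓ U i j := by
      refine (inf_eq_left.2 ?_).symm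
      exact Finset.inf_le (f := fun p : n × n => U p.1 p.2) (Finset.mem_univ (i, j))
    change ‖E.cutoff V (M i j)‖ < δ
    rw [hV, ← cutoff_cutoff]
    exact (E.norm_cutoff_le _ _).trans_lt (hU i j)

theorem evalPi_surjective (hX : coveringDim X = 0) (m n : ℕ) [NeZero m] (x : X) :
    Function.Surjective (E.evalPi m n x) := by
  let _ := CStarAlgebra.spectralOrder A
  have _ := CStarAlgebra.spectralOrderedRing A
  let _ := E.fiberCStarAlgebra hX x
  let _ := CStarAlgebra.spectralOrder (E.Fiber x)
  have _ := CStarAlgebra.spectralOrderedRing (E.Fiber x)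
  -- `CStarMatrix` supplies the C*-norm; its `*`-ring structure and topology are by definition those
  -- of `Matrix`. The spectral orders serve only to define that norm.
  exact (E.isGermMap (n := Fin n) hX x).quasiPiMap_surjective (N := Fin m)

theorem exists_cutoffPi_eq_one (hX : coveringDim X = 0) {m n : ℕ} [NeZero m] {x : X}
    {a : QuasiPi (Fin m) (Matrix (Fin n) (Fin n) A)} (ha : E.evalPi m n x a = 1) :
    ∃ U : Clopens X, x ∈ U ∧ E.cutoffPi m n U a = 1 := by
  let _ := CStarAlgebra.spectralOrder A
  have _ := CStarAlgebra.spectralOrderedRing A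
  let _ := E.fiberCStarAlgebra hX x
  let _ := CStarAlgebra.spectralOrder (E.Fiber x)
  have _ := CStarAlgebra.spectralOrderedRing (E.Fiber x)
  have key := fun β hβ =>
    (E.isGermMap (n := Fin n) hX x).exists_quasiPiMap_eq_cls_const (N := Fin m) (β := β) hβ
  obtain ⟨_, ⟨U, hxU, rfl⟩, h⟩ := key a ha
  exact ⟨U, hxU, h⟩

theorem rationallyKStable_of_fibers (hX : coveringDim X = 0)
    (hfib : ∀ x : X, RationallyKStable (E.Fiber x)) : RationallyKStable A := by
  intro m _ n hn
  let ι := quasiPiMap (Fin m) (cornerInclusion n A) (continuous_cornerInclusion n)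
  let ιx := fun x => quasiPiMap (Fin m) (cornerInclusion n (E.Fiber x))
    (continuous_cornerInclusion n)
  have hcut : ∀ U a, ι (E.cutoffPi m n U a) = E.cutoffPi m (n + 1) U (ι a) := fun U a =>
    quasiPiMap_comm _ _ _ _ (fun M => (matrixMap_cornerInclusion _ n M).symm) a
  have heval : ∀ x a, ιx x (E.evalPi m n x a) = E.evalPi m (n + 1) x (ι a) := fun x a =>
    quasiPiMap_comm _ _ _ _ (fun M => (matrixMap_cornerInclusion _ n M).symm) a
  have hx := fun x => (ratNonstableKMap_bijective_iff m _ _).1 (hfib x m n hn)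
  refine (ratNonstableKMap_bijective_iff m _ _).2 ⟨fun a ha => ?_, fun b => ?_⟩
  -- Kernel: some power of `a` evaluates trivially at `x`, so a cutoff near `x` kills it.
  · refine (E.isCutoffFamily_cutoffPi m n).exists_pow_eq_one a fun x => ?_
    obtain ⟨k, hk, h⟩ := (hx x).1 (E.evalPi m n x a)
      ((heval x a).trans ((congrArg _ ha).trans (map_one _)))
    rw [← map_pow] at h
    obtain ⟨U, hxU, hU⟩ := E.exists_cutoffPi_eq_one hX h
    exact ⟨U, hxU, k, hk, by rw [← map_pow, hU]⟩
  · refine (E.isCutoffFamily_cutoffPi m (n + 1)).exists_map_eq_pow ι hcut b fun x => ?_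
    obtain ⟨k, hk, a', h⟩ := (hx x).2 (E.evalPi m (n + 1) x b)
    obtain ⟨a, rfl⟩ := E.evalPi_surjective hX m n x a'
    -- Cokernel: the fiber equation is lifted, and its error evaluates trivially, so it disappears
    -- after a cutoff near `x`.
    have h1 : E.evalPi m (n + 1) x (ι a * (b ^ k)⁻¹) = 1 := by
      rw [map_mul, map_inv, map_pow, mul_inv_eq_one, ← heval]
      exact h
    obtain ⟨U, hxU, hU⟩ := E.exists_cutoffPi_eq_one hX h1
    refine ⟨U, hxU, k, hk, E.cutoffPi m n U a, ?_⟩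
    rw [map_mul, map_inv, map_pow, mul_inv_eq_one] at hU
    rw [hcut, hU]

end CXAlgebra

end Matrix

end RatKStable

end

theorem mainTheorem3 {X A : Type*} [TopologicalSpace X] [CompactSpace X] [T2Space X]
    (hX : RatKStable.coveringDim X = 0) [NonUnitalCStarAlgebra A]
    (E : RatKStable.CXAlgebra X A) (hE : E.IsContinuous)
    (hfib : ∀ x : X, RatKStable.RationallyKStable (E.Fiber x)) :
    RatKStable.RationallyKStable A :=
  E.rationallyKStable_of_fibers hX hfib
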